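/- Let $d,k\ge 2$ be integers with $(d,k)\neq(2,2)$. Let $\sigma$ be the surface measure on the unit sphere $\mathbb S^{d-1}\subset\mathbb R^d$, let $\sigma^k$ be the product measure on $(\mathbb S^{d-1})^k$, and let $\overline{B(k)}\subset\mathbb R^d$ be the closed ball of radius $k$ centered at the origin. Let $f_1,\dots,f_k:\mathbb S^{d-1}\to\mathbb C$ be $\sigma$-measurable functions and let $h:\overline{B(k)}\to\mathbb C$ be a Lebesgue measurable function such that $$f_1(\zeta_1)f_2(\zeta_2)\cdots f_k(\zeta_k)=h(\zeta_1+\zeta_2+\dots+\zeta_k)$$ for $\sigma^k$-a.e. $(\zeta_1,\dots,\zeta_k)\in(\mathbb S^{d-1})^k$. Then one of the following holds: (i) there exist $c_1,\dots,c_k\in\mathbb C\setminus\{0\}$ and $\nu\in\mathbb C^d$ such that, for every $j=1,\dots,k$, $f_j(\zeta)=c_j\,e^{\nu\cdot\zeta}$ for $\sigma$-a.e. $\zeta\in\mathbb S^{d-1}$, where $\nu\cdot\zeta=\sum_{i=1}^d\nu_i\zeta_i$; (ii) for some $j$ with $1\le j\le k$, $f_j(\zeta)=0$ for $\sigma$-a.e.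 $\zeta\in\mathbb S^{d-1}$. -/

import Mathlib

open MeasureTheory Metric

noncomputable section

/-- The Euclidean unit sphere of `ℝ^d`. -/
abbrev UnitSphere (d : ℕ) : Type :=
  sphere (0 : EuclideanSpace ℝ (Fin d)) 1

/-- The surface measure on the unit sphere of `ℝ^d` (not normalized). -/
def surfaceMeasure (d : ℕ) : Measure (UnitSphere d) :=
  (volume : Measure (EuclideanSpace ℝ (Fin d))).toSphere

instance (d : ℕ) : IsFiniteMeasure (surfaceMeasure d) :=
  inferInstanceAs (IsFiniteMeasure (volume : Measure (EuclideanSpace ℝ (Fin d))).toSphere)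

/-- The bilinear (not sesquilinear) product `ν · ζ = ∑ ν_i ζ_i` of `ν ∈ ℂ^d` and `ζ ∈ ℝ^d`. -/
def complexDot {d : ℕ} (ν : Fin d → ℂ) (ζ : EuclideanSpace ℝ (Fin d)) : ℂ :=
  ∑ i, ν i * ((ζ i : ℝ) : ℂ)

end

open Filter Set Module
open scoped Topology ENNReal Pointwise RealInnerProductSpace

/-!
Fixing all but two (or three) of the variables at generic points shows that every `f j` is
proportional to one function `F` such that `F x * F y` (or `F x * F y * F z`) is almost everywhere
a function of the sum. It suffices to find a function `P` near the origin with
`P (s + (z - z')) * F z' = P s * F z` which satisfies a Pexider equation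
`P (s + v) = P s * χ v`: after mollification such a `P` is `c * exp ∘ l` with `l` linear, so that
`F * exp (-l)` is locally constant on the sphere, which is connected.

In dimension two almost every point of the ball of radius `2` is a sum of two points of the circle,
and the sum map and its section carry null sets to null sets. One takes `P s = F x * F y` for
`x + y = s`; the third factor provides the relation between `P` and `F`.

In dimension at least three the pairs with a given sum form a null set with many elements. The
relation `F x * F y = F x' * F y'` for `x + y = x' + y'` is recovered at every such quadruple for
almost every rotation of `F`, since rotations act continuously in `L¹`. It shows first that the
nonvanishing set is closed under completing right angles, hence is everything, and then that
`F x / F y` depends only on the chord `x - y`. These ratios are multiplicative on orthogonal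
chords, hence on all short ones, and they serve as `P`.
-/

section Reduction

variable {ι X W K : Type*} [Fintype ι] [MeasurableSpace X] {μ : Measure X} [SigmaFinite μ]
  [AddCommMonoid W] [Field K] {f : ι → X → K} {p : X → W} {h : W → K}

theorem exists_ae_prod_comp_embedding_eq {κ : Type*} [Fintype κ] (e : κ ↪ ι)
    (hf : ∀ j, ¬ ∀ᵐ x ∂μ, f j x = 0)
    (heq : ∀ᵐ x ∂Measure.pi fun _ : ι => μ, ∏ j, f j (x j) = h (∑ j, p (x j))) :
    ∃ H : W → K, ∀ᵐ x ∂Measure.pi fun _ : κ => μ,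
      ∏ i, f (e i) (x i) = H (∑ i, p (x i)) := by
  classical
  let κ' := ↥(range e)ᶜ
  let ε : κ' ⊕ κ ≃ ι := (Equiv.sumComm κ' κ).trans
    (((Equiv.ofInjective e e.injective).sumCongr (.refl κ')).trans (Equiv.Set.sumCompl _))
  have hsplit : ∀ᵐ z ∂(Measure.pi fun _ : κ' => μ).prod (Measure.pi fun _ : κ => μ),
      (∏ i : κ', f i (z.1 i)) * ∏ i, f (e i) (z.2 i)
        = h (∑ i, p (z.1 i) + ∑ i, p (z.2 i)) := by
    have hmp := (measurePreserving_piCongrLeft (fun _ : ι => μ) ε).comp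
      (measurePreserving_sumPiEquivProdPi_symm fun _ : κ' ⊕ κ => μ)
    have hval (z : (κ' → X) × (κ → X)) (i : κ' ⊕ κ) :
        MeasurableEquiv.piCongrLeft (fun _ => X) ε
          ((MeasurableEquiv.sumPiEquivProdPi fun _ => X).symm z) (ε i) = Sum.elim z.1 z.2 i := by
      rw [MeasurableEquiv.piCongrLeft_apply_apply]
      cases i <;> rfl
    filter_upwards [hmp.quasiMeasurePreserving.ae heq] with z hz
    simp only [Function.comp_apply, ← ε.prod_comp, ← ε.sum_comp, hval, Fintype.prod_sum_type,
      Fintype.sum_sum_type, Sum.elim_inl, Sum.elim_inr] at hz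
    exact hz
  have hpos : (Measure.pi fun _ : κ' => μ) (univ.pi fun i => {x | f i x ≠ 0}) ≠ 0 := by
    rw [Measure.pi_pi]
    exact Finset.prod_ne_zero_iff.2 fun i _ => hf i
  obtain ⟨y, hy, hyeq⟩ := ((frequently_ae_mem_iff.2 hpos).and_eventually
    (Measure.ae_ae_of_ae_prod hsplit)).exists
  refine ⟨fun w => (∏ i : κ', f i (y i))⁻¹ * h (∑ i, p (y i) + w), hyeq.mono fun x hx => ?_⟩
  exact (eq_inv_mul_iff_mul_eq₀ (Finset.prod_ne_zero_iff.2 fun i _ => hy i (mem_univ i))).2 hx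

theorem exists_ae_mul_eq {i j : ι} (hij : i ≠ j) (hf : ∀ j, ¬ ∀ᵐ x ∂μ, f j x = 0)
    (heq : ∀ᵐ x ∂Measure.pi fun _ : ι => μ, ∏ j, f j (x j) = h (∑ j, p (x j))) :
    ∃ H : W → K, ∀ᵐ z ∂μ.prod μ, f i z.1 * f j z.2 = H (p z.1 + p z.2) := by
  have hinj : Function.Injective ![i, j] := by
    simpa [Function.Injective, Fin.forall_fin_two] using ⟨hij, hij.symm⟩
  obtain ⟨H, hH⟩ := exists_ae_prod_comp_embedding_eq ⟨![i, j], hinj⟩ hf heq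
  refine ⟨H, ?_⟩
  filter_upwards [(measurePreserving_finTwoArrow μ).symm.quasiMeasurePreserving.ae hH] with z hz
  simpa [Fin.prod_univ_two, Fin.sum_univ_two] using hz

/-- The right-hand side of the pair equation is symmetric, so `f x * g y = f y * g x`. -/
theorem exists_ae_eq_const_mul_of_ae_mul_eq {f g : X → K} (hf : ¬ ∀ᵐ x ∂μ, f x = 0)
    (hg : ¬ ∀ᵐ x ∂μ, g x = 0) (heq : ∀ᵐ z ∂μ.prod μ, f z.1 * g z.2 = h (p z.1 + p z.2)) :
    ∃ c ≠ 0, ∀ᵐ x ∂μ, g x = c * f x := by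
  have hswap : ∀ᵐ z ∂μ.prod μ, f z.1 * g z.2 = f z.2 * g z.1 := by
    filter_upwards [heq, Measure.measurePreserving_swap.quasiMeasurePreserving.ae heq]
      with z hz hz'
    exact hz.trans ((congrArg h (add_comm _ _)).trans hz'.symm)
  obtain ⟨y, hy, hyeq⟩ :=
    ((not_eventually.1 hf).and_eventually (Measure.ae_ae_of_ae_prod hswap)).exists
  have hgf : ∀ᵐ x ∂μ, g x = g y / f y * f x := hyeq.mono fun x hx => by
    rw [div_mul_eq_mul_div, eq_div_iff hy]
    linear_combination hx
  refine ⟨g y / f y, fun hc => hg (hgf.mono fun x hx => ?_), hgf⟩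
  rw [hx, hc, zero_mul]

theorem exists_ae_eq_const_mul_of_ae_prod_eq (i : ι) (hf : ∀ j, ¬ ∀ᵐ x ∂μ, f j x = 0)
    (heq : ∀ᵐ x ∂Measure.pi fun _ : ι => μ, ∏ j, f j (x j) = h (∑ j, p (x j))) (j : ι) :
    ∃ c ≠ 0, ∀ᵐ x ∂μ, f j x = c * f i x := by
  obtain rfl | hij := eq_or_ne i j
  · exact ⟨1, one_ne_zero, by simp⟩
  obtain ⟨H, hH⟩ := exists_ae_mul_eq hij hf heq
  exact exists_ae_eq_const_mul_of_ae_mul_eq (hf i) (hf j) hH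

theorem exists_ae_prod_self_eq {κ : Type*} [Fintype κ] (e : κ ↪ ι) (i : ι)
    (hf : ∀ j, ¬ ∀ᵐ x ∂μ, f j x = 0)
    (heq : ∀ᵐ x ∂Measure.pi fun _ : ι => μ, ∏ j, f j (x j) = h (∑ j, p (x j))) :
    ∃ H : W → K, ∀ᵐ x ∂Measure.pi fun _ : κ => μ, ∏ k, f i (x k) = H (∑ k, p (x k)) := by
  choose c hc0 hc using exists_ae_eq_const_mul_of_ae_prod_eq i hf heq
  obtain ⟨H, hH⟩ := exists_ae_prod_comp_embedding_eq e hf heq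
  refine ⟨fun w => (∏ k, c (e k))⁻¹ * H w, ?_⟩
  have hcoord : ∀ᵐ x ∂Measure.pi fun _ : κ => μ, ∀ k, f (e k) (x k) = c (e k) * f i (x k) :=
    eventually_all.2 fun k =>
      (Measure.quasiMeasurePreserving_eval (fun _ => μ) k).ae (hc (e k))
  filter_upwards [hH, hcoord] with x hx hxc
  rw [← hx, Finset.prod_congr rfl fun k _ => hxc k, Finset.prod_mul_distrib,
    inv_mul_cancel_left₀ (Finset.prod_ne_zero_iff.2 fun k _ => hc0 (e k))]

theorem exists_ae_mul_self_eq (hι : 2 ≤ Fintype.card ι) (i : ι)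
    (hf : ∀ j, ¬ ∀ᵐ x ∂μ, f j x = 0)
    (heq : ∀ᵐ x ∂Measure.pi fun _ : ι => μ, ∏ j, f j (x j) = h (∑ j, p (x j))) :
    ∃ H : W → K, ∀ᵐ z ∂μ.prod μ, f i z.1 * f i z.2 = H (p z.1 + p z.2) := by
  obtain ⟨e⟩ := Function.Embedding.nonempty_of_card_le (α := Fin 2) (by simpa using hι)
  obtain ⟨H, hH⟩ := exists_ae_prod_self_eq e i hf heq
  refine ⟨H, ?_⟩
  filter_upwards [(measurePreserving_finTwoArrow μ).symm.quasiMeasurePreserving.ae hH] with z hz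
  simpa [Fin.prod_univ_two, Fin.sum_univ_two] using hz

theorem exists_ae_mul_mul_self_eq (hι : 3 ≤ Fintype.card ι) (i : ι)
    (hf : ∀ j, ¬ ∀ᵐ x ∂μ, f j x = 0)
    (heq : ∀ᵐ x ∂Measure.pi fun _ : ι => μ, ∏ j, f j (x j) = h (∑ j, p (x j))) :
    ∃ H : W → K, ∀ᵐ z ∂μ.prod (μ.prod μ),
      f i z.1 * (f i z.2.1 * f i z.2.2) = H (p z.1 + (p z.2.1 + p z.2.2)) := by
  obtain ⟨e⟩ := Function.Embedding.nonempty_of_card_le (α := Fin 3) (by simpa using hι)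
  obtain ⟨H, hH⟩ := exists_ae_prod_self_eq e i hf heq
  refine ⟨H, ?_⟩
  have hmp := (measurePreserving_piFinSuccAbove (fun _ : Fin 3 => μ) 0).symm.comp
    ((MeasurePreserving.id μ).prod (measurePreserving_finTwoArrow μ).symm)
  filter_upwards [hmp.quasiMeasurePreserving.ae hH] with z hz
  simpa [Fin.prod_univ_succ, Fin.sum_univ_succ] using hz

end Reduction

section LocalPexider

theorem exists_nat_measure_le_norm_lt {α F : Type*} [MeasurableSpace α] [NormedAddCommGroup F]
    [MeasurableSpace F] [OpensMeasurableSpace F] (μ : Measure α) [IsFiniteMeasure μ] {g : α → F}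
    (hg : Measurable g) {ε : ℝ≥0∞} (hε : ε ≠ 0) : ∃ n : ℕ, μ {x | (n : ℝ) ≤ ‖g x‖} < ε := by
  have hinter : ⋂ n : ℕ, {x | (n : ℝ) ≤ ‖g x‖} = ∅ := by
    refine eq_empty_of_forall_notMem fun x hx => ?_
    obtain ⟨n, hn⟩ := exists_nat_gt ‖g x‖
    exact hn.not_ge (mem_iInter.1 hx n)
  have htendsto : Tendsto (fun n : ℕ => μ {x | (n : ℝ) ≤ ‖g x‖}) atTop (𝓝 0) := by
    rw [← measure_empty (μ := μ), ← hinter]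
    exact tendsto_measure_iInter_atTop
      (fun n => (measurableSet_le measurable_const hg.norm).nullMeasurableSet)
      (fun n m hnm x (hx : (m : ℝ) ≤ _) => (Nat.cast_le.2 hnm).trans hx) ⟨0, measure_ne_top μ _⟩
  exact (htendsto.eventually_lt_const hε.bot_lt).exists

theorem exists_eq_mul_exp_of_local_cauchy {V : Type*} [NormedAddCommGroup V] [NormedSpace ℝ V]
    {q : V → ℂ} (hq : Differentiable ℝ q) {s₀ : V} (hs₀ : q s₀ ≠ 0) {r : ℝ}
    (h : ∀ v ∈ ball (0 : V) r, ∀ᶠ s in 𝓝 s₀, q (s + v) * q s₀ = q s * q (s₀ + v)) :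
    ∃ l : V →L[ℝ] ℂ, ∀ v ∈ ball (0 : V) r, q (s₀ + v) = q s₀ * Complex.exp (l v) := by
  let l : V →L[ℝ] ℂ := (q s₀)⁻¹ • fderiv ℝ q s₀
  have hderiv : ∀ v ∈ ball (0 : V) r, fderiv ℝ q (s₀ + v) = q (s₀ + v) • l := by
    intro v hv
    have hleft : HasFDerivAt (fun s => q (s + v) * q s₀) (q s₀ • fderiv ℝ q (s₀ + v)) s₀ :=
      ((hq (s₀ + v)).hasFDerivAt.comp s₀ ((hasFDerivAt_id s₀).add_const v)).mul_const (q s₀)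
    have hright : HasFDerivAt (fun s => q s * q (s₀ + v)) (q (s₀ + v) • fderiv ℝ q s₀) s₀ :=
      (hq s₀).hasFDerivAt.mul_const _
    have heq := (hleft.congr_of_eventuallyEq ((h v hv).mono fun s hs => hs.symm)).unique hright
    rw [smul_comm, ← heq, smul_smul, inv_mul_cancel₀ hs₀, one_smul]
  let g : V → ℂ := fun v => q (s₀ + v) * Complex.exp (-l v)
  have hg : ∀ v ∈ ball (0 : V) r, HasFDerivAt g (0 : V →L[ℝ] ℂ) v := by
    intro v hv
    have hqv : HasFDerivAt (fun v => q (s₀ + v)) (fderiv ℝ q (s₀ + v)) v :=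
      (hq (s₀ + v)).hasFDerivAt.comp v ((hasFDerivAt_id v).const_add s₀)
    refine (hqv.mul l.hasFDerivAt.neg.cexp).congr_fderiv ?_
    ext w
    simp only [hderiv v hv, add_apply, smul_apply, neg_apply, smul_eq_mul, zero_apply]
    ring
  refine ⟨l, fun v hv => ?_⟩
  have hconst : g v = g 0 := isOpen_ball.is_const_of_fderiv_eq_zero (𝕜 := ℝ)
    (convex_ball (0 : V) r).isPreconnected
    (fun v hv => (hg v hv).differentiableAt.differentiableWithinAt)
    (fun v hv => (hg v hv).fderiv) hv (mem_ball_self (pos_of_mem_ball hv))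
  simp only [g, map_zero, neg_zero, Complex.exp_zero, mul_one, add_zero] at hconst
  rw [← hconst, mul_assoc, ← Complex.exp_add, neg_add_cancel, Complex.exp_zero, mul_one]

variable {V : Type*} [NormedAddCommGroup V] [MeasurableSpace V] [BorelSpace V] {μ : Measure V}
  [μ.IsAddHaarMeasure] {P χ : V → ℂ} {r : ℝ}

theorem ae_ne_zero_of_local_pexider (hr : 0 < r)
    (h : ∀ᵐ v ∂μ, ∀ᵐ s ∂μ, s ∈ ball 0 r → v ∈ ball 0 r → P (s + v) = P s * χ v)
    (hP0 : ∀ᵐ s ∂μ, s ∈ ball 0 (2 * r) → P s ≠ 0) :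
    ∀ᵐ v ∂μ, v ∈ ball 0 r → χ v ≠ 0 := by
  filter_upwards [h] with v hv hvr hχv
  have hpos : μ (ball 0 r) ≠ 0 := (measure_ball_pos μ 0 hr).ne'
  obtain ⟨s, hsr, hsv, hs0⟩ := ((frequently_ae_mem_iff.2 hpos).and_eventually
    (hv.and ((measurePreserving_add_right μ v).quasiMeasurePreserving.ae hP0))).exists
  have hsv2 : s + v ∈ ball (0 : V) (2 * r) := by
    rw [mem_ball_zero_iff] at *
    linarith [norm_add_le s v]
  exact hs0 hsv2 (by rw [hsv hsr hvr, hχv, mul_zero])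

variable [NormedSpace ℝ V]

theorem exists_ae_eq_exp_of_ae_mul_eq {q : V → ℂ} (hq : Differentiable ℝ q) {U : Set V}
    (hU : IsOpen U) {s₀ : V} (hs₀U : s₀ ∈ U) (hs₀ : q s₀ ≠ 0)
    (h : ∀ᵐ v ∂μ, v ∈ ball 0 r → ∀ s ∈ U, q (s + v) = q s * χ v) :
    ∃ l : V →L[ℝ] ℂ, ∀ᵐ v ∂μ, v ∈ ball 0 r → χ v = Complex.exp (l v) := by
  have hqc : Continuous q := hq.continuous
  have hcauchy : ∀ v ∈ ball (0 : V) r, ∀ s ∈ U, q (s + v) * q s₀ = q s * q (s₀ + v) := by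
    intro v hv s hs
    refine Measure.eqOn_open_of_ae_eq (μ := μ) (f := fun v => q (s + v) * q s₀)
      (g := fun v => q s * q (s₀ + v)) ?_ isOpen_ball (by fun_prop) (by fun_prop) hv
    filter_upwards [ae_restrict_of_ae h, ae_restrict_mem measurableSet_ball] with v hv hvr
    rw [hv hvr s hs, hv hvr s₀ hs₀U]
    ring
  obtain ⟨l, hl⟩ := exists_eq_mul_exp_of_local_cauchy hq hs₀ fun v hv =>
    mem_of_superset (hU.mem_nhds hs₀U) fun s hs => hcauchy v hv s hs
  refine ⟨l, h.mono fun v hv hvr => mul_left_cancel₀ hs₀ ?_⟩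
  rw [← hv hvr s₀ hs₀U, hl v hvr]

variable [FiniteDimensional ℝ V]

theorem exists_convolution_normed_ne_zero {Q : V → ℂ} (hQ : LocallyIntegrable Q μ) {U : Set V}
    (hU : ∃ᵐ s ∂μ, s ∈ U ∧ Q s ≠ 0) {ε : ℝ} (hε : 0 < ε) :
    ∃ φ : ContDiffBump (0 : V), φ.rOut < ε ∧
      ∃ s ∈ U, convolution (φ.normed μ) Q (ContinuousLinearMap.lsmul ℝ ℝ) μ s ≠ 0 := by
  let φ : ℕ → ContDiffBump (0 : V) := fun n =>
    ⟨(1 / (n + 1 : ℝ)) / 2, 1 / (n + 1 : ℝ), by positivity, half_lt_self (by positivity)⟩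
  have hφ : Tendsto (fun n => (φ n).rOut) atTop (𝓝 0) :=
    tendsto_one_div_add_atTop_nhds_zero_nat
  have hφ' : ∀ᶠ n in atTop, (φ n).rOut ≤ 2 * (φ n).rIn :=
    Eventually.of_forall fun n => (mul_div_cancel₀ _ two_ne_zero).ge
  obtain ⟨s, ⟨hsU, hQs⟩, hs⟩ := (hU.and_eventually
    (ContDiffBump.ae_convolution_tendsto_right_of_locallyIntegrable hφ hφ' hQ)).exists
  obtain ⟨n, hn, hnε⟩ := ((hs.eventually_ne hQs).and (hφ.eventually_lt_const hε)).exists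
  exact ⟨φ n, hnε, s, hsU, hn⟩

/-- Whatever `s` is, some `v` avoids both the set where `P (s + v)` is large and the set where
`χ v` is small. -/
theorem ae_norm_le_of_local_pexider (hP : Measurable P) (hχ : Measurable χ) (hr : 0 < r)
    (h : ∀ᵐ s ∂μ, ∀ᵐ v ∂μ, s ∈ ball 0 r → v ∈ ball 0 r → P (s + v) = P s * χ v)
    (hχ0 : ∀ᵐ v ∂μ, v ∈ ball 0 r → χ v ≠ 0) :
    ∃ C, ∀ᵐ s ∂μ, s ∈ ball 0 r → ‖P s‖ ≤ C := by
  have hball (ρ : ℝ) : IsFiniteMeasure (μ.restrict (ball 0 ρ)) :=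
    isFiniteMeasure_restrict.2 measure_ball_lt_top.ne
  have hm : μ (ball 0 r) / 2 ≠ 0 :=
    (ENNReal.half_pos (measure_ball_pos μ 0 hr).ne').ne'
  obtain ⟨n, hn⟩ := exists_nat_measure_le_norm_lt (μ.restrict (ball 0 (2 * r))) hP hm
  obtain ⟨k, hk⟩ := exists_nat_measure_le_norm_lt (μ.restrict (ball 0 r)) hχ.inv hm
  rw [Measure.restrict_apply (measurableSet_le measurable_const hP.norm)] at hn
  rw [Measure.restrict_apply (measurableSet_le measurable_const hχ.inv.norm)] at hk
  set B := {u | (n : ℝ) ≤ ‖P u‖} ∩ ball 0 (2 * r)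
  set A := {v | (k : ℝ) ≤ ‖χ⁻¹ v‖} ∩ ball 0 r
  refine ⟨n * k, ?_⟩
  filter_upwards [h] with s hs hsr
  have hfreq : ∃ᵐ v ∂μ, v ∈ ball 0 r ∧ v ∉ A ∪ (s + ·) ⁻¹' B := by
    intro hall
    have hle : μ (ball 0 r) ≤ μ (A ∪ (s + ·) ⁻¹' B) :=
      measure_mono_ae (hall.mono fun v hv hvr => not_not.1 fun hvA => hv ⟨hvr, hvA⟩)
    refine hle.not_gt ((measure_union_le _ _).trans_lt ?_)
    rw [measure_preimage_add, ← ENNReal.add_halves (μ (ball 0 r))]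
    exact ENNReal.add_lt_add hk hn
  obtain ⟨v, ⟨hvr, hvAB⟩, hv, hv0⟩ := (hfreq.and_eventually (hs.and hχ0)).exists
  simp only [A, B, mem_union, mem_inter_iff, mem_preimage, mem_ofPred_eq, not_or, not_and',
    not_le] at hvAB
  have hsv : s + v ∈ ball (0 : V) (2 * r) := by
    rw [mem_ball_zero_iff] at *
    linarith [norm_add_le s v]
  calc ‖P s‖ = ‖P (s + v)‖ * ‖χ⁻¹ v‖ := by
        rw [hv hsr hvr, norm_mul, Pi.inv_apply, norm_inv,
          mul_inv_cancel_right₀ (norm_ne_zero_iff.2 (hv0 hvr))]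
    _ ≤ n * k := by gcongr; exacts [(hvAB.2 hsv).le, (hvAB.1 hvr).le]

theorem convolution_normed_indicator_eq_mul {φ : ContDiffBump (0 : V)} {s v : V} {a : ℂ}
    (hv : ∀ᵐ t ∂μ, t ∈ ball 0 r → P (t + v) = P t * a)
    (hsv : ‖s‖ + φ.rOut + ‖v‖ ≤ r) :
    convolution (φ.normed μ) ((ball 0 r).indicator P) (ContinuousLinearMap.lsmul ℝ ℝ) μ (s + v)
      = convolution (φ.normed μ) ((ball 0 r).indicator P) (ContinuousLinearMap.lsmul ℝ ℝ) μ s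
        * a := by
  simp only [convolution, ContinuousLinearMap.lsmul_apply]
  rw [← integral_mul_const]
  refine integral_congr_ae ?_
  filter_upwards [(quasiMeasurePreserving_sub_left μ s).ae hv] with t ht
  by_cases hts : t ∈ ball 0 φ.rOut
  · have htφ : ‖t‖ < φ.rOut := mem_ball_zero_iff.1 hts
    have hst : s - t ∈ ball (0 : V) r := by
      rw [mem_ball_zero_iff]
      linarith [norm_sub_le s t, norm_nonneg v]
    have hstv : s - t + v ∈ ball (0 : V) r := by
      rw [mem_ball_zero_iff]
      linarith [norm_sub_le s t, norm_add_le (s - t) v]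
    rw [add_sub_right_comm, indicator_of_mem hstv, indicator_of_mem hst, ht hst, smul_mul_assoc]
  · rw [← φ.support_normed_eq (μ := μ), Function.notMem_support] at hts
    simp only [hts, zero_smul, zero_mul]

/-- Mollifying `P` turns the almost everywhere equation into one between smooth functions. -/
theorem exists_ae_eq_exp_right_of_local_pexider (hP : Measurable P) (hχ : Measurable χ)
    (hr : 0 < r)
    (h : ∀ᵐ z ∂μ.prod μ, z.1 ∈ ball 0 r → z.2 ∈ ball 0 r → P (z.1 + z.2) = P z.1 * χ z.2)
    (hP0 : ∀ᵐ s ∂μ, s ∈ ball 0 (2 * r) → P s ≠ 0) :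
    ∃ l : V →L[ℝ] ℂ, ∀ᵐ v ∂μ, v ∈ ball 0 (r / 2) → χ v = Complex.exp (l v) := by
  have hvs : ∀ᵐ v ∂μ, ∀ᵐ s ∂μ, s ∈ ball 0 r → v ∈ ball 0 r → P (s + v) = P s * χ v :=
    Measure.ae_ae_of_ae_prod (Measure.measurePreserving_swap.quasiMeasurePreserving.ae h)
  obtain ⟨C, hC⟩ := ae_norm_le_of_local_pexider hP hχ hr (Measure.ae_ae_of_ae_prod h)
    (ae_ne_zero_of_local_pexider hr hvs hP0)
  have hQ : LocallyIntegrable ((ball 0 r).indicator P) μ := by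
    refine Integrable.locallyIntegrable ((integrable_indicator_iff measurableSet_ball).2 ?_)
    exact Measure.integrableOn_of_bounded measure_ball_lt_top.ne hP.aestronglyMeasurable
      ((ae_restrict_iff' measurableSet_ball).2 hC)
  have hpos : μ (ball 0 (r / 4)) ≠ 0 := (measure_ball_pos μ 0 (by positivity)).ne'
  have hfreq : ∃ᵐ s ∂μ, s ∈ ball 0 (r / 4) ∧ (ball 0 r).indicator P s ≠ 0 := by
    refine ((frequently_ae_mem_iff.2 hpos).and_eventually hP0).mono fun s hs => ⟨hs.1, ?_⟩
    rw [indicator_of_mem (ball_subset_ball (by linarith) hs.1)]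
    exact hs.2 (ball_subset_ball (by linarith) hs.1)
  obtain ⟨φ, hφ, s₀, hs₀, hs₀0⟩ :=
    exists_convolution_normed_ne_zero (μ := μ) hQ hfreq (show 0 < r / 4 by positivity)
  have hsmooth := (φ.hasCompactSupport_normed (μ := μ)).contDiff_convolution_left (n := 1)
    (ContinuousLinearMap.lsmul ℝ ℝ) φ.contDiff_normed hQ
  refine exists_ae_eq_exp_of_ae_mul_eq (hsmooth.differentiable one_ne_zero) isOpen_ball hs₀ hs₀0 ?_
  filter_upwards [hvs] with v hv hvr s hs
  rw [mem_ball_zero_iff] at hvr hs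
  exact convolution_normed_indicator_eq_mul
    (hv.mono fun t ht htr => ht htr (mem_ball_zero_iff.2 (by linarith))) (by linarith)

theorem exists_ae_eq_const_mul_exp_of_local_pexider (hP : Measurable P) (hχ : Measurable χ)
    (hr : 0 < r)
    (h : ∀ᵐ z ∂μ.prod μ, z.1 ∈ ball 0 r → z.2 ∈ ball 0 r → P (z.1 + z.2) = P z.1 * χ z.2)
    (hP0 : ∀ᵐ s ∂μ, s ∈ ball 0 (2 * r) → P s ≠ 0) :
    ∃ c ≠ 0, ∃ l : V →L[ℝ] ℂ, ∀ᵐ s ∂μ, s ∈ ball 0 (r / 4) → P s = c * Complex.exp (l s) := by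
  obtain ⟨l, hl⟩ := exists_ae_eq_exp_right_of_local_pexider hP hχ hr h hP0
  have hpos : μ (ball 0 (r / 4)) ≠ 0 := (measure_ball_pos μ 0 (by positivity)).ne'
  obtain ⟨s, hs, hs0, hsv⟩ := ((frequently_ae_mem_iff.2 hpos).and_eventually
    (hP0.and (Measure.ae_ae_of_ae_prod h))).exists
  refine ⟨P s * Complex.exp (-l s),
    mul_ne_zero (hs0 (ball_subset_ball (by linarith) hs)) (Complex.exp_ne_zero _), l, ?_⟩
  filter_upwards [(measurePreserving_sub_right μ s).quasiMeasurePreserving.ae (hsv.and hl)]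
    with u hu hur
  have hus : u - s ∈ ball (0 : V) (r / 2) := by
    rw [mem_ball_zero_iff] at *
    linarith [norm_sub_le u s]
  have hPu := hu.1 (ball_subset_ball (by linarith) hs) (ball_subset_ball (by linarith) hus)
  rw [hu.2 hus, add_sub_cancel] at hPu
  rw [hPu, mul_assoc, ← Complex.exp_add, map_sub, neg_add_eq_sub]

end LocalPexider

section AEConstant

variable {X α : Type*} {u : X → α}

theorem ae_eq_const_of_forall_nhds [TopologicalSpace X] [SecondCountableTopology X]
    [PreconnectedSpace X] [Nonempty X] [MeasurableSpace X] (μ : Measure X) [μ.IsOpenPosMeasure]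
    (h : ∀ x, ∃ c, ∃ U ∈ 𝓝 x, ∀ᵐ z ∂μ, z ∈ U → u z = c) : ∃ c, ∀ᵐ z ∂μ, u z = c := by
  choose c U hU hc using h
  have hloc : IsLocallyConstant c := by
    refine (IsLocallyConstant.iff_eventually_eq c).2 fun x => ?_
    filter_upwards [eventually_mem_nhds_iff.2 (hU x)] with y hy
    obtain ⟨z, ⟨hzx, hzy⟩, hcx, hcy⟩ := ((frequently_ae_mem_iff.2
      (Measure.measure_pos_of_mem_nhds μ (inter_mem hy (hU y))).ne').and_eventually
        ((hc x).and (hc y))).exists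
    exact (hcy hzy).symm.trans (hcx hzx)
  obtain ⟨x₀⟩ := ‹Nonempty X›
  refine ⟨c x₀, measure_null_of_locally_null _ fun x _ =>
    ⟨{z | ¬ u z = c x₀} ∩ U x, inter_mem_nhdsWithin _ (hU x), ?_⟩⟩
  refine measure_mono_null ?_ (hc x)
  rintro z ⟨hz, hzU⟩ hzc
  refine hz ((hzc hzU).trans ?_)
  exact hloc.apply_eq_of_isPreconnected isPreconnected_univ (mem_univ x) (mem_univ x₀)

theorem ae_eq_const_of_ae_dist_lt [PseudoMetricSpace X] [SecondCountableTopology X]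
    [PreconnectedSpace X] [Nonempty X] [MeasurableSpace X] (μ : Measure X) [μ.IsOpenPosMeasure]
    {δ : ℝ} (hδ : 0 < δ) (h : ∀ᵐ z' ∂μ, ∀ᵐ z ∂μ, dist z z' < δ → u z = u z') :
    ∃ c, ∀ᵐ z ∂μ, u z = c := by
  refine ae_eq_const_of_forall_nhds μ fun x => ?_
  have hpos : μ (ball x (δ / 2)) ≠ 0 := (measure_ball_pos μ x (by positivity)).ne'
  obtain ⟨z', hz'x, hz'⟩ := ((frequently_ae_mem_iff.2 hpos).and_eventually h).exists
  refine ⟨u z', ball x (δ / 2), ball_mem_nhds x (by positivity), hz'.mono fun z hz hzx => hz ?_⟩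
  linarith [dist_triangle_right z z' x, mem_ball.1 hzx, mem_ball.1 hz'x]

end AEConstant

theorem mul_exp_neg_eq_of_ae_translate {V : Type*} [NormedAddCommGroup V] [NormedSpace ℝ V]
    [MeasurableSpace V] [BorelSpace V] {μ : Measure V} [μ.IsAddHaarMeasure] {P : V → ℂ} {c : ℂ}
    {l : V →L[ℝ] ℂ} {δ : ℝ} {w w' : V} {a a' : ℂ} (hc : c ≠ 0)
    (hP : ∀ᵐ s ∂μ, s ∈ ball 0 (2 * δ) → P s = c * Complex.exp (l s)) (hw : ‖w - w'‖ < δ)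
    (h : ∀ᵐ s ∂μ, s ∈ ball 0 δ → P (s + (w - w')) * a' = P s * a) :
    a * Complex.exp (-l w) = a' * Complex.exp (-l w') := by
  have hδ : 0 < δ := (norm_nonneg _).trans_lt hw
  have hpos : μ (ball 0 δ) ≠ 0 := (measure_ball_pos μ 0 hδ).ne'
  obtain ⟨s, hs, hsw, hPsw, hPs⟩ := ((frequently_ae_mem_iff.2 hpos).and_eventually
    (h.and (((measurePreserving_add_right μ (w - w')).quasiMeasurePreserving.ae hP).and
      hP))).exists
  specialize hsw hs
  rw [mem_ball_zero_iff] at hs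
  rw [hPsw (mem_ball_zero_iff.2 (by linarith [norm_add_le s (w - w')])),
    hPs (mem_ball_zero_iff.2 (by linarith)), map_add, Complex.exp_add, map_sub,
    Complex.exp_sub] at hsw
  have hexp_s := Complex.exp_ne_zero (l s)
  have hexp_w := Complex.exp_ne_zero (l w)
  have hexp_w' := Complex.exp_ne_zero (l w')
  rw [Complex.exp_neg, Complex.exp_neg]
  field_simp at hsw ⊢
  exact hsw.symm

section NullSets

variable {V W : Type*} [NormedAddCommGroup V] [NormedSpace ℝ V] [FiniteDimensional ℝ V]
  [MeasurableSpace V] [BorelSpace V] [NormedAddCommGroup W] [NormedSpace ℝ W]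
  [FiniteDimensional ℝ W] [MeasurableSpace W] [BorelSpace W] {μ : Measure V}
  [μ.IsAddHaarMeasure] {τ : Measure W} [τ.IsAddHaarMeasure] {f : V → W}

theorem addHaar_image_eq_zero_of_differentiable (h : finrank ℝ V = finrank ℝ W)
    (hf : Differentiable ℝ f) {s : Set V} (hs : μ s = 0) : τ (f '' s) = 0 := by
  let e : W ≃L[ℝ] V := .ofFinrankEq h.symm
  have : (τ.map e).IsAddHaarMeasure := e.isAddHaarMeasure_map τ
  have hnull : τ.map e ((e ∘ f) '' s) = 0 :=
    addHaar_image_eq_zero_of_differentiableOn_of_addHaar_eq_zero _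
      (e.differentiable.comp hf).differentiableOn
      (Measure.absolutelyContinuous_isAddHaarMeasure _ μ hs)
  have hmap : τ.map e (e '' (f '' s)) = τ (e ⁻¹' (e '' (f '' s))) :=
    e.toHomeomorph.toMeasurableEquiv.map_apply _
  rwa [image_comp, hmap, preimage_image_eq _ e.injective] at hnull

theorem addHaar_inter_preimage_eq_zero_of_antilipschitz (h : finrank ℝ V = finrank ℝ W)
    {s : Set V} {K : NNReal} (hf : AntilipschitzWith K (s.domRestrict f)) {N : Set W}
    (hN : τ N = 0) : μ (s ∩ f ⁻¹' N) = 0 := by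
  let d : ℝ := finrank ℝ V
  have hdW : (Measure.hausdorffMeasure d : Measure W).IsAddHaarMeasure := by
    simp only [d, h]
    infer_instance
  have hpre : Measure.hausdorffMeasure d (s.domRestrict f ⁻¹' N) = 0 := by
    refine nonpos_iff_eq_zero.1 ((hf.hausdorffMeasure_preimage_le (Nat.cast_nonneg _) N).trans ?_)
    rw [Measure.absolutelyContinuous_isAddHaarMeasure _ τ hN, mul_zero]
  refine Measure.absolutelyContinuous_isAddHaarMeasure μ (Measure.hausdorffMeasure d) ?_
  rw [← Subtype.image_preimage_coe,
    isometry_subtype_coe.hausdorffMeasure_image (.inl (Nat.cast_nonneg _))]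
  exact hpre

/-- Near a point where its strict derivative is invertible, `f` is antilipschitz. -/
theorem quasiMeasurePreserving_of_ae_hasStrictFDerivAt (hf : Measurable f)
    (h : ∀ᵐ x ∂μ, ∃ f' : V ≃L[ℝ] W, HasStrictFDerivAt f (f' : V →L[ℝ] W) x) :
    Measure.QuasiMeasurePreserving f μ τ := by
  refine ⟨hf, .mk fun N hN hN0 => ?_⟩
  rw [Measure.map_apply hf hN, ← measure_inter_conull (ae_iff.1 h)]
  refine measure_null_of_locally_null _ fun x hx => ?_
  obtain ⟨f', hf'⟩ : ∃ f' : V ≃L[ℝ] W, HasStrictFDerivAt f (f' : V →L[ℝ] W) x := hx.2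
  obtain ⟨s, hxs, hs, hfs⟩ := hf'.approximates_deriv_on_open_nhds
  have hanti := hfs.antilipschitz
    (f'.subsingleton_or_nnnorm_symm_pos.imp id fun h => half_lt_self (inv_pos.2 h))
  refine ⟨s ∩ f ⁻¹' N, ?_, addHaar_inter_preimage_eq_zero_of_antilipschitz
    f'.toLinearEquiv.finrank_eq hanti hN0⟩
  exact mem_nhdsWithin.2 ⟨s, hs, hxs, fun y hy => ⟨hy.1, hy.2.1⟩⟩

end NullSets

theorem smulInvariantMeasure_prod {M X Y : Type*} [MeasurableSpace X] [MeasurableSpace Y]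
    [SMul M X] [SMul M Y] [MeasurableConstSMul M X] [MeasurableConstSMul M Y] (μ : Measure X)
    (τ : Measure Y) [SigmaFinite μ] [SigmaFinite τ] [SMulInvariantMeasure M X μ]
    [SMulInvariantMeasure M Y τ] : SMulInvariantMeasure M (X × Y) (μ.prod τ) :=
  ⟨fun g _ hs => ((measurePreserving_smul g μ).prod
    (measurePreserving_smul g τ)).measure_preimage hs.nullMeasurableSet⟩

section HomogeneousSpace

variable {G X : Type*} [Group G] [MeasurableSpace X] [MulAction G X]

variable {μ : Measure X}

theorem ae_of_ae_comp_smul [MeasurableConstSMul G X] [SMulInvariantMeasure G X μ] {p : X → Prop}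
    (g : G) (h : ∀ᵐ x ∂μ, p (g • x)) : ∀ᵐ x ∂μ, p x := by
  simpa only [smul_inv_smul] using (tendsto_smul_ae μ g⁻¹).eventually h

variable [MeasurableSpace G] {ν : Measure G}

theorem ae_ae_smul [MeasurableSMul₂ G X] [SFinite μ] [SFinite ν] [SMulInvariantMeasure G X μ]
    {p : X → Prop} (h : ∀ᵐ x ∂μ, p x) : ∀ᵐ x ∂μ, ∀ᵐ g ∂ν, p (g • x) := by
  have hqmp : Measure.QuasiMeasurePreserving (fun z : X × G => z.2 • z.1) (μ.prod ν) μ :=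
    QuasiMeasurePreserving.prod_of_left (measurable_snd.smul measurable_fst)
      (.of_forall fun g => (measurePreserving_smul g μ).quasiMeasurePreserving)
  exact Measure.ae_ae_of_ae_prod (hqmp.ae h)

variable [MeasurableMul G] [ν.IsMulRightInvariant]

theorem ae_mul_right {p : G → Prop} (h : ∀ᵐ g ∂ν, p g) (k : G) : ∀ᵐ g ∂ν, p (g * k) :=
  (measurePreserving_mul_right ν k).quasiMeasurePreserving.ae h

variable [MulAction.IsPretransitive G X]

theorem map_smul_measure_eq [MeasurableSMul G X] (x y : X) :
    ν.map (fun g => g • x) = ν.map fun g => g • y := by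
  obtain ⟨k, rfl⟩ := MulAction.exists_smul_eq G x y
  calc ν.map (fun g => g • x) = (ν.map (· * k)).map fun g => g • x := by rw [map_mul_right_eq_self]
    _ = ν.map fun g => g • k • x := by
      rw [Measure.map_map (measurable_smul_const x) (measurable_mul_const k)]
      simp only [Function.comp_def, mul_smul]

theorem ae_of_ae_smul [MeasurableSMul₂ G X] [SFinite μ] [SFinite ν] [NeZero ν]
    [SMulInvariantMeasure G X μ] {p : X → Prop} (hp : MeasurableSet {x | p x}) {x : X}
    (h : ∀ᵐ g ∂ν, p (g • x)) : ∀ᵐ y ∂μ, p y := by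
  have hall (y : X) : ∀ᵐ g ∂ν, p (g • y) := by
    obtain ⟨k, rfl⟩ := MulAction.exists_smul_eq G x y
    exact (ae_mul_right h k).mono fun g hg => by rwa [← mul_smul]
  obtain ⟨g, hg⟩ := ((Measure.ae_ae_comm (μ := μ) (p := fun y (g : G) => p (g • y))
    ((measurable_snd.smul measurable_fst) hp)).1 (.of_forall hall)).exists
  exact ae_of_ae_comp_smul g hg

variable [TopologicalSpace G] [R1Space G] [BorelSpace G] [TopologicalSpace X] [R1Space X]
  [BorelSpace X] [ContinuousSMul G X] [IsFiniteMeasure ν] [ν.InnerRegularCompactLTTop]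
  {F : Type*} [NormedAddCommGroup F] [NormedSpace ℝ F] {f : X → F}

/-- Since `G` acts transitively, the maps `g ↦ g • x` all push `ν` to the same measure, and
precomposition with a measure-preserving map is continuous in `L¹`. A homeomorphism of `F` onto its
unit ball makes `f` integrable. -/
theorem exists_strictMono_ae_tendsto_smul (hf : StronglyMeasurable f) {z : ℕ → X} {z₀ : X}
    (hz : Tendsto z atTop (𝓝 z₀)) : ∃ φ : ℕ → ℕ, StrictMono φ ∧
      ∀ᵐ g ∂ν, Tendsto (fun n => f (g • z (φ n))) atTop (𝓝 (f (g • z₀))) := by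
  set b : F → F := fun w => (Homeomorph.unitBall w : F)
  have hb : Continuous b := continuous_subtype_val.comp Homeomorph.unitBall.continuous
  have hL : MemLp (fun x => b (f x)) 1 (ν.map fun g => g • z₀) :=
    .of_bound (hb.comp_stronglyMeasurable hf).aestronglyMeasurable 1
      (.of_forall fun x => (mem_ball_zero_iff.1 (Homeomorph.unitBall (f x)).2).le)
  let T : X → C(G, X) := fun x => ⟨fun g => g • x, by fun_prop⟩
  have hT : Continuous T := ContinuousMap.continuous_of_continuous_uncurry _
    (by fun_prop : Continuous fun q : X × G => q.2 • q.1)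
  have hTm (x : X) : MeasurePreserving (T x) ν (ν.map fun g => g • z₀) :=
    ⟨(T x).continuous.measurable, map_smul_measure_eq x z₀⟩
  have hlim := (tendsto_const_nhds (x := hL.toLp _)).compMeasurePreservingLp
    ((hT.tendsto z₀).comp hz) (fun n => hTm (z n)) (hTm z₀) ENNReal.one_ne_top
  obtain ⟨φ, hφ, hφlim⟩ := (tendstoInMeasure_of_tendsto_Lp hlim).exists_seq_tendsto_ae
  have hcoe (x : X) : ∀ᵐ g ∂ν,
      Lp.compMeasurePreserving (T x) (hTm x) (hL.toLp _) g = b (f (g • x)) := by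
    filter_upwards [Lp.coeFn_compMeasurePreserving (hL.toLp _) (hTm x),
      (hTm x).quasiMeasurePreserving.ae hL.coeFn_toLp] with g h₁ h₂
    exact h₁.trans h₂
  refine ⟨φ, hφ, ?_⟩
  filter_upwards [hφlim, ae_all_iff.2 fun n => hcoe (z n), hcoe z₀] with g hlim hn h₀
  have hball : Tendsto (fun n => Homeomorph.unitBall (f (g • z (φ n)))) atTop
      (𝓝 (Homeomorph.unitBall (f (g • z₀)))) :=
    tendsto_subtype_rng.2 ((h₀ ▸ hlim).congr fun n => hn (φ n))
  simpa only [Function.comp_def, Homeomorph.symm_apply_apply] using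
    (Homeomorph.unitBall.symm.continuous.tendsto _).comp hball

theorem exists_strictMono_forall_ae_tendsto_smul {κ : Type*} [Finite κ]
    (hf : StronglyMeasurable f) {z : ℕ → κ → X} {z₀ : κ → X} (hz : Tendsto z atTop (𝓝 z₀)) :
    ∃ φ : ℕ → ℕ, StrictMono φ ∧
      ∀ k, ∀ᵐ g ∂ν, Tendsto (fun n => f (g • z (φ n) k)) atTop (𝓝 (f (g • z₀ k))) := by
  classical
  have := Fintype.ofFinite κ
  suffices h : ∀ s : Finset κ, ∃ φ : ℕ → ℕ, StrictMono φ ∧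
      ∀ k ∈ s, ∀ᵐ g ∂ν, Tendsto (fun n => f (g • z (φ n) k)) atTop (𝓝 (f (g • z₀ k))) by
    simpa only [Finset.mem_univ, true_imp_iff] using h Finset.univ
  intro s
  induction s using Finset.induction_on with
  | empty => exact ⟨id, strictMono_id, by simp⟩
  | insert k s _ ih =>
    obtain ⟨φ, hφ, hs⟩ := ih
    obtain ⟨ψ, hψ, hk⟩ := exists_strictMono_ae_tendsto_smul (ν := ν) hf
      ((tendsto_pi_nhds.1 hz k).comp hφ.tendsto_atTop)
    refine ⟨φ ∘ ψ, hφ.comp hψ, (Finset.forall_mem_insert _ _ _).2 ⟨hk, fun i hi => ?_⟩⟩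
    exact (hs i hi).mono fun g hg => hg.comp hψ.tendsto_atTop

theorem ae_smul_mem_of_tendsto {κ : Type*} [Finite κ] (hf : StronglyMeasurable f)
    {z : ℕ → κ → X} {z₀ : κ → X} (hz : Tendsto z atTop (𝓝 z₀)) {C : Set (κ → F)}
    (hC : IsClosed C) (h : ∀ n, ∀ᵐ g ∂ν, (fun k => f (g • z n k)) ∈ C) :
    ∀ᵐ g ∂ν, (fun k => f (g • z₀ k)) ∈ C := by
  obtain ⟨φ, -, hφ⟩ := exists_strictMono_forall_ae_tendsto_smul (ν := ν) hf hz
  filter_upwards [ae_all_iff.2 hφ, ae_all_iff.2 h] with g hlim hg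
  exact hC.mem_of_tendsto (tendsto_pi_nhds.2 hlim) (.of_forall fun n => hg (φ n))

end HomogeneousSpace

section Sphere

variable {E : Type*} [NormedAddCommGroup E] [InnerProductSpace ℝ E]

local notation "𝕊" => sphere (0 : E) 1

theorem exists_norm_eq_one_inner_eq_zero (hE : 3 ≤ finrank ℝ E) (u v : E) :
    ∃ n : E, ‖n‖ = 1 ∧ ⟪u, n⟫ = 0 ∧ ⟪v, n⟫ = 0 := by
  classical
  set K : Submodule ℝ E := Submodule.span ℝ ({u, v} : Finset E)
  have hK2 : finrank ℝ K ≤ 2 := (finrank_span_finset_le_card _).trans Finset.card_le_two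
  have hne : Kᗮ ≠ ⊥ := by
    rw [Ne, Submodule.orthogonal_eq_bot_iff]
    intro h
    rw [h, finrank_top] at hK2
    omega
  obtain ⟨n, hn, hn0⟩ := Submodule.exists_mem_ne_zero_of_ne_bot hne
  have horth (w : E) (hw : w ∈ ({u, v} : Finset E)) : ⟪w, NormedSpace.normalize n⟫ = 0 := by
    rw [NormedSpace.normalize, inner_smul_right, (Submodule.mem_orthogonal K n).1 hn w
      (Submodule.subset_span hw), mul_zero]
  exact ⟨NormedSpace.normalize n, NormedSpace.norm_normalize hn0, horth u (by simp),
    horth v (by simp)⟩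

theorem exists_norm_eq_one_eq_norm_smul (hE : 3 ≤ finrank ℝ E) {u v q : E} (hu : ⟪u, q⟫ = 0)
    (hv : ⟪v, q⟫ = 0) : ∃ n : E, ‖n‖ = 1 ∧ ⟪u, n⟫ = 0 ∧ ⟪v, n⟫ = 0 ∧ q = ‖q‖ • n := by
  rcases eq_or_ne q 0 with rfl | hq
  · obtain ⟨n, hn, hun, hvn⟩ := exists_norm_eq_one_inner_eq_zero hE u v
    exact ⟨n, hn, hun, hvn, by rw [norm_zero, zero_smul]⟩
  · exact ⟨NormedSpace.normalize q, NormedSpace.norm_normalize hq,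
      by rw [NormedSpace.normalize, inner_smul_right, hu, mul_zero],
      by rw [NormedSpace.normalize, inner_smul_right, hv, mul_zero],
      (NormedSpace.norm_smul_normalize q).symm⟩

theorem exists_inner_eq_zero_norm_sq_eq (hE : 3 ≤ finrank ℝ E) (u v : E) {κ : ℝ} (hκ : 0 ≤ κ) :
    ∃ w : E, ⟪u, w⟫ = 0 ∧ ⟪v, w⟫ = 0 ∧ ‖w‖ ^ 2 = κ := by
  obtain ⟨n, hn, hun, hvn⟩ := exists_norm_eq_one_inner_eq_zero hE u v
  refine ⟨√κ • n, by rw [inner_smul_right, hun, mul_zero],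
    by rw [inner_smul_right, hvn, mul_zero], ?_⟩
  rw [norm_smul, hn, mul_one, Real.norm_eq_abs, sq_abs, Real.sq_sqrt hκ]

theorem connectedSpace_sphere (hE : 2 ≤ finrank ℝ E) : ConnectedSpace 𝕊 :=
  Subtype.connectedSpace (isConnected_sphere (Module.lt_rank_of_lt_finrank hE) _ zero_le_one)

theorem abs_inner_sphere_le_one (a b : 𝕊) : |⟪(a : E), b⟫| ≤ 1 :=
  (abs_real_inner_le_norm _ _).trans_eq (by simp only [norm_eq_of_mem_sphere, mul_one])

theorem inner_self_sphere (a : 𝕊) : ⟪(a : E), a⟫ = 1 := by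
  rw [real_inner_self_eq_norm_sq, norm_eq_of_mem_sphere, one_pow]

theorem add_sub_mem_sphere {a b c : 𝕊} (h : ⟪(c : E) - a, (c : E) - b⟫ = 0) :
    (a + b - c : E) ∈ 𝕊 := by
  rw [mem_sphere_zero_iff_norm, ← sq_eq_sq₀ (norm_nonneg _) zero_le_one,
    ← real_inner_self_eq_norm_sq]
  simp only [inner_add_left, inner_add_right, inner_sub_left, inner_sub_right, inner_self_sphere,
    real_inner_comm (c : E), real_inner_comm (a : E) b] at h ⊢
  linear_combination 2 * h

theorem exists_norm_eq_one_inner_eq_zero_sphere_eq (hE : 3 ≤ finrank ℝ E) (m p : 𝕊) :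
    ∃ u : E, ‖u‖ = 1 ∧ ⟪(m : E), u⟫ = 0 ∧
      (p : E) = ⟪(m : E), p⟫ • (m : E) + √(1 - ⟪(m : E), p⟫ ^ 2) • u := by
  set α := ⟪(m : E), p⟫ with hα
  set q : E := p - α • (m : E) with hq
  have hmq : ⟪(m : E), q⟫ = 0 := by
    rw [hq, inner_sub_right, inner_smul_right, inner_self_sphere, ← hα, mul_one, sub_self]
  have hnq : ‖q‖ ^ 2 = 1 - α ^ 2 := by
    rw [hq, norm_sub_sq_real, inner_smul_right, real_inner_comm, ← hα, norm_smul,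
      norm_eq_of_mem_sphere, norm_eq_of_mem_sphere, mul_one, Real.norm_eq_abs, sq_abs]
    ring
  have hsqrt : √(1 - α ^ 2) = ‖q‖ := by rw [← hnq, Real.sqrt_sq (norm_nonneg q)]
  obtain ⟨u, hu, hmu, -, hqu⟩ := exists_norm_eq_one_eq_norm_smul hE hmq hmq
  exact ⟨u, hu, hmu, by rw [hsqrt, ← hqu, hq, add_sub_cancel]⟩

/-- Subtracting the two equations gives `t ^ 2 - √(1 - α ^ 2) * t + c ^ 2 - α * c = 0`, a quadratic
equation with discriminant `1 - (2 * c - α) ^ 2`. -/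
theorem exists_sq_add_sq_add_sq_eq_one {c α : ℝ} (hc : 0 ≤ c) (hα : |α| ≤ 1)
    (h : 2 * c - 1 ≤ α) :
    ∃ t s : ℝ, c ^ 2 + t ^ 2 + s ^ 2 = 1 ∧ (c - α) ^ 2 + (t - √(1 - α ^ 2)) ^ 2 = s ^ 2 := by
  set β := √(1 - α ^ 2)
  have hβ : β ^ 2 = 1 - α ^ 2 :=
    Real.sq_sqrt (sub_nonneg.2 ((sq_le_one_iff_abs_le_one α).2 hα))
  have hD : √(1 - (2 * c - α) ^ 2) ^ 2 = 1 - (2 * c - α) ^ 2 :=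
    Real.sq_sqrt (sub_nonneg.2 ((sq_le_one_iff_abs_le_one _).2
      (abs_le.2 ⟨by linarith [(abs_le.1 hα).2], by linarith⟩)))
  set t := (β + √(1 - (2 * c - α) ^ 2)) / 2 with ht
  have ht2 : t ^ 2 - β * t + c ^ 2 - α * c = 0 := by
    rw [ht]
    linear_combination (1 / 4) * hD - (1 / 4) * hβ
  have hs : √((c - α) ^ 2 + (t - β) ^ 2) ^ 2 = (c - α) ^ 2 + (t - β) ^ 2 :=
    Real.sq_sqrt (by positivity)
  exact ⟨t, _, by linear_combination hs + 2 * ht2 + hβ, hs.symm⟩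

/-- A set of points of the sphere is closed under right angles if it contains every point from which
two of its points are seen at a right angle. -/
def IsRightAngleClosed (Z : Set 𝕊) : Prop :=
  ∀ a ∈ Z, ∀ b ∈ Z, ∀ c : 𝕊, ⟪(c : E) - a, (c : E) - b⟫ = 0 → c ∈ Z

variable {Z : Set (sphere (0 : E) 1)}

namespace IsRightAngleClosed

/-- With `p = α • m + β • u` and `v` orthogonal to `m` and `u`, there are two points
`c • m + t • u ± s • v` of the slice from which `p` is seen at a right angle. -/
theorem cap_subset_of_slice_subset (hZ : IsRightAngleClosed Z) (hE : 3 ≤ finrank ℝ E) {m : 𝕊}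
    {c : ℝ} (hc : 0 ≤ c) (h : ∀ p : 𝕊, ⟪(m : E), p⟫ = c → p ∈ Z) {p : 𝕊}
    (hp : 2 * c - 1 ≤ ⟪(m : E), p⟫) : p ∈ Z := by
  obtain ⟨u, hu, hmu, hpu⟩ := exists_norm_eq_one_inner_eq_zero_sphere_eq hE m p
  obtain ⟨v, hv, hmv, huv⟩ := exists_norm_eq_one_inner_eq_zero hE (m : E) u
  obtain ⟨t, s, hts, hs⟩ := exists_sq_add_sq_add_sq_eq_one hc (abs_inner_sphere_le_one m p) hp
  have hm := inner_self_sphere m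
  have hu' : ⟪u, u⟫ = 1 := by rw [real_inner_self_eq_norm_sq, hu, one_pow]
  have hv' : ⟪v, v⟫ = 1 := by rw [real_inner_self_eq_norm_sq, hv, one_pow]
  have hum : ⟪u, (m : E)⟫ = 0 := by rw [real_inner_comm, hmu]
  have hvm : ⟪v, (m : E)⟫ = 0 := by rw [real_inner_comm, hmv]
  have hvu : ⟪v, u⟫ = 0 := by rw [real_inner_comm, huv]
  have hmem (τ : ℝ) (hτ : τ ^ 2 = s ^ 2) : c • (m : E) + t • u + τ • v ∈ 𝕊 := by
    rw [mem_sphere_zero_iff_norm, ← sq_eq_sq₀ (norm_nonneg _) zero_le_one,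
      ← real_inner_self_eq_norm_sq]
    simp only [inner_add_left, inner_add_right, inner_smul_left, inner_smul_right, hm, hu', hv',
      hmu, hmv, hum, hvm, hvu, huv, conj_trivial]
    linear_combination hτ + hts
  have hslice (τ : ℝ) (hτ : τ ^ 2 = s ^ 2) : ⟨_, hmem τ hτ⟩ ∈ Z := h _ (by
    simp only [inner_add_right, inner_smul_right, hm, hmu, hmv]
    ring)
  refine hZ _ (hslice s rfl) _ (hslice (-s) (neg_sq s)) p ?_
  rw [hpu]
  simp only [inner_add_left, inner_add_right, inner_sub_left, inner_sub_right, inner_smul_left,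
    inner_smul_right, hm, hu', hv', hmu, hmv, hum, hvm, hvu, huv, conj_trivial]
  linear_combination hs

/-- A slice at height `c` gives one at height `max (2 * c - 1) 0`, so finitely many steps lead to
the equator, whose cap is the whole sphere. -/
theorem eq_univ_of_slice_subset (hZ : IsRightAngleClosed Z) (hE : 3 ≤ finrank ℝ E) {m : 𝕊} {c : ℝ}
    (hc : 0 ≤ c) (hc1 : c < 1) (h : ∀ p : 𝕊, ⟪(m : E), p⟫ = c → p ∈ Z) : Z = univ := by
  obtain ⟨n, hn⟩ := exists_pow_lt_of_lt_one (sub_pos.2 hc1) one_half_lt_one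
  replace hn := hn.le
  clear hc1
  induction n generalizing c with
  | zero =>
    refine eq_univ_of_forall fun p => hZ.cap_subset_of_slice_subset hE hc h ?_
    rw [pow_zero] at hn
    linarith [neg_le_of_abs_le (abs_inner_sphere_le_one m p)]
  | succ n ih =>
    refine ih (c := max (2 * c - 1) 0) (le_max_right _ _) (fun p hp => ?_) ?_
    · exact hZ.cap_subset_of_slice_subset hE hc h (hp ▸ le_max_left _ _)
    · rw [le_sub_comm, max_le_iff]
      rw [pow_succ] at hn
      exact ⟨by linarith, sub_nonneg.2 (pow_le_one₀ (by norm_num) (by norm_num))⟩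

theorem eq_univ (hZ : IsRightAngleClosed Z) (hE : 3 ≤ finrank ℝ E) {a b : 𝕊} (ha : a ∈ Z)
    (hb : b ∈ Z) (hab : a ≠ b) : Z = univ := by
  have hright (p : 𝕊) : ⟪(p : E) - a, (p : E) - b⟫ = ‖(a + b : E)‖ ^ 2 / 2 - ⟪(a + b : E), p⟫ := by
    rw [← real_inner_self_eq_norm_sq]
    simp only [inner_add_left, inner_add_right, inner_sub_left, inner_sub_right, inner_self_sphere,
      real_inner_comm (a : E)]
    rw [real_inner_comm (b : E) p]
    ring
  rcases eq_or_ne (a + b : E) 0 with h0 | h0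
  · refine eq_univ_of_forall fun p => hZ a ha b hb p ?_
    rw [hright, h0, norm_zero, inner_zero_left]
    norm_num
  have hlt : ‖(a + b : E)‖ < 2 := by
    have := norm_add_lt_of_not_sameRay (x := (a : E)) (y := b) fun hray =>
      hab (Subtype.ext (hray.eq_of_norm_eq (by simp only [norm_eq_of_mem_sphere])))
    simp only [norm_eq_of_mem_sphere] at this
    linarith
  refine hZ.eq_univ_of_slice_subset hE (c := ‖(a + b : E)‖ / 2)
    (m := ⟨NormedSpace.normalize (a + b : E), by simpa using NormedSpace.norm_normalize h0⟩)
    (by positivity) (by linarith) fun p hp => hZ a ha b hb p ?_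
  rw [hright]
  simp only [NormedSpace.normalize, inner_smul_left, conj_trivial] at hp
  rw [inv_mul_eq_iff_eq_mul₀ (norm_ne_zero_iff.2 h0)] at hp
  rw [hp]
  ring

end IsRightAngleClosed

theorem exists_sphere_sub_eq_sub_eq (hE : 3 ≤ finrank ℝ E) {u v : E} (huv : ⟪u, v⟫ = 0)
    (h : ‖u‖ ^ 2 + ‖v‖ ^ 2 ≤ 4) : ∃ a b c : 𝕊, (a - b : E) = u ∧ (b - c : E) = v := by
  obtain ⟨n, hun, hvn, hn⟩ := exists_inner_eq_zero_norm_sq_eq hE u v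
    (κ := 1 - (‖u‖ ^ 2 + ‖v‖ ^ 2) / 4) (by linarith)
  have hmem (ε δ : ℝ) (hε : ε ^ 2 = 1 / 4) (hδ : δ ^ 2 = 1 / 4) : ε • u + δ • v + n ∈ 𝕊 := by
    have hvu : ⟪v, u⟫ = 0 := by rw [real_inner_comm, huv]
    have hnu : ⟪n, u⟫ = 0 := by rw [real_inner_comm, hun]
    have hnv : ⟪n, v⟫ = 0 := by rw [real_inner_comm, hvn]
    rw [mem_sphere_zero_iff_norm, ← sq_eq_sq₀ (norm_nonneg _) zero_le_one,
      ← real_inner_self_eq_norm_sq]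
    simp only [inner_add_left, inner_add_right, inner_smul_left, inner_smul_right, huv, hvu, hun,
      hvn, hnu, hnv, real_inner_self_eq_norm_sq, hn, conj_trivial]
    linear_combination ‖u‖ ^ 2 * hε + ‖v‖ ^ 2 * hδ
  refine ⟨⟨_, hmem (1 / 2) (1 / 2) (by norm_num) (by norm_num)⟩,
    ⟨_, hmem (-1 / 2) (1 / 2) (by norm_num) (by norm_num)⟩,
    ⟨_, hmem (-1 / 2) (-1 / 2) (by norm_num) (by norm_num)⟩, ?_, ?_⟩ <;> module

section ChordCharacter

variable {Γ : Type*} [CommGroup Γ] {A : sphere (0 : E) 1 → Γ} {φ : E → Γ}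

theorem map_add_of_map_sphere_sub_of_inner_eq_zero (hE : 3 ≤ finrank ℝ E)
    (hφ : ∀ x x' : 𝕊, φ (x - x') = A x / A x') {u v : E} (huv : ⟪u, v⟫ = 0)
    (h : ‖u‖ ^ 2 + ‖v‖ ^ 2 ≤ 4) : φ (u + v) = φ u * φ v := by
  obtain ⟨a, b, c, rfl, rfl⟩ := exists_sphere_sub_eq_sub_eq hE huv h
  rw [sub_add_sub_cancel, hφ, hφ, hφ, div_mul_div_cancel]

theorem map_neg_of_map_sphere_sub (hE : 3 ≤ finrank ℝ E)
    (hφ : ∀ x x' : 𝕊, φ (x - x') = A x / A x') {u : E} (hu : ‖u‖ ≤ 2) : φ (-u) = (φ u)⁻¹ := by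
  obtain ⟨a, b, -, rfl, -⟩ := exists_sphere_sub_eq_sub_eq hE (inner_zero_right u)
    (by rw [norm_zero]; nlinarith [norm_nonneg u])
  rw [neg_sub, hφ, hφ, inv_div]

/-- With `w` orthogonal to `u` and `v` and `‖w‖ ^ 2 = ⟪u, v⟫`, the vectors `u + w` and `v - w` are
orthogonal. -/
theorem map_add_of_map_sphere_sub_of_inner_nonneg (hE : 3 ≤ finrank ℝ E)
    (hφ : ∀ x x' : 𝕊, φ (x - x') = A x / A x') {u v : E} (hu : ‖u‖ ≤ 1) (hv : ‖v‖ ≤ 1)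
    (huv : 0 ≤ ⟪u, v⟫) : φ (u + v) = φ u * φ v := by
  obtain ⟨w, huw, hvw, hwsq⟩ := exists_inner_eq_zero_norm_sq_eq hE u v huv
  have huvle : ⟪u, v⟫ ≤ 1 := (real_inner_le_norm u v).trans (mul_le_one₀ hu (norm_nonneg v) hv)
  have hu2 : ‖u‖ ^ 2 ≤ 1 := pow_le_one₀ (norm_nonneg u) hu
  have hv2 : ‖v‖ ^ 2 ≤ 1 := pow_le_one₀ (norm_nonneg v) hv
  have horth : ⟪u + w, v + -w⟫ = 0 := by
    rw [inner_add_left, inner_add_right, inner_add_right, inner_neg_right, inner_neg_right, huw,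
      real_inner_comm v w, hvw, real_inner_self_eq_norm_sq, hwsq]
    ring
  have hnu : ‖u + w‖ ^ 2 = ‖u‖ ^ 2 + ⟪u, v⟫ := by rw [norm_add_sq_real, huw, hwsq]; ring
  have hnv : ‖v + -w‖ ^ 2 = ‖v‖ ^ 2 + ⟪u, v⟫ := by
    rw [norm_add_sq_real, inner_neg_right, hvw, norm_neg, hwsq]; ring
  calc φ (u + v) = φ ((u + w) + (v + -w)) := by congr 1; abel
    _ = φ (u + w) * φ (v + -w) :=
      map_add_of_map_sphere_sub_of_inner_eq_zero hE hφ horth (by linarith)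
    _ = φ u * φ w * (φ v * φ (-w)) := by
      rw [map_add_of_map_sphere_sub_of_inner_eq_zero hE hφ huw (by linarith),
        map_add_of_map_sphere_sub_of_inner_eq_zero hE hφ (u := v) (v := -w)
          (by rw [inner_neg_right, hvw, neg_zero]) (by rw [norm_neg]; linarith)]
    _ = φ u * φ v := by
      rw [map_neg_of_map_sphere_sub hE hφ (u := w) (by nlinarith), mul_mul_mul_comm,
        mul_inv_cancel, mul_one]

theorem map_add_of_map_sphere_sub (hE : 3 ≤ finrank ℝ E)
    (hφ : ∀ x x' : 𝕊, φ (x - x') = A x / A x') {u v : E} (hu : ‖u‖ ≤ 1) (hv : ‖v‖ ≤ 1) :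
    φ (u + v) = φ u * φ v := by
  rcases le_total 0 ⟪u, v⟫ with huv | huv
  · exact map_add_of_map_sphere_sub_of_inner_nonneg hE hφ hu hv huv
  obtain ⟨w, huw, hvw, hwsq⟩ := exists_inner_eq_zero_norm_sq_eq hE u v (neg_nonneg.2 huv)
  have huvge : -⟪u, v⟫ ≤ 1 := (neg_le_abs _).trans
    ((abs_real_inner_le_norm u v).trans (mul_le_one₀ hu (norm_nonneg v) hv))
  have hu2 : ‖u‖ ^ 2 ≤ 1 := pow_le_one₀ (norm_nonneg u) hu
  have hv2 : ‖v‖ ^ 2 ≤ 1 := pow_le_one₀ (norm_nonneg v) hv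
  have hw1 : ‖w‖ ≤ 1 := (sq_le_one_iff₀ (norm_nonneg w)).1 (by linarith)
  have horth : ⟪u + w, v + w⟫ = 0 := by
    rw [inner_add_left, inner_add_right, inner_add_right, huw, real_inner_comm v w, hvw,
      real_inner_self_eq_norm_sq, hwsq]
    ring
  have horth' : ⟪u + v, w + w⟫ = 0 := by
    rw [inner_add_left, inner_add_right, inner_add_right, huw, hvw]
    norm_num
  have hnu : ‖u + w‖ ^ 2 = ‖u‖ ^ 2 - ⟪u, v⟫ := by rw [norm_add_sq_real, huw, hwsq]; ring
  have hnv : ‖v + w‖ ^ 2 = ‖v‖ ^ 2 - ⟪u, v⟫ := by rw [norm_add_sq_real, hvw, hwsq]; ring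
  have hnw : ‖w + w‖ ^ 2 = -4 * ⟪u, v⟫ := by
    rw [← two_smul ℝ w, norm_smul, mul_pow, hwsq, Real.norm_ofNat]; ring
  refine mul_right_cancel (b := φ w * φ w) ?_
  calc φ (u + v) * (φ w * φ w) = φ (u + v) * φ (w + w) := by
        rw [map_add_of_map_sphere_sub_of_inner_nonneg hE hφ hw1 hw1 real_inner_self_nonneg]
    _ = φ ((u + v) + (w + w)) := (map_add_of_map_sphere_sub_of_inner_eq_zero hE hφ horth'
        (by rw [norm_add_sq_real]; linarith)).symm
    _ = φ ((u + w) + (v + w)) := by rw [add_add_add_comm]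
    _ = φ (u + w) * φ (v + w) :=
      map_add_of_map_sphere_sub_of_inner_eq_zero hE hφ horth (by linarith)
    _ = φ u * φ w * (φ v * φ w) := by
      rw [map_add_of_map_sphere_sub_of_inner_eq_zero hE hφ huw (by linarith),
        map_add_of_map_sphere_sub_of_inner_eq_zero hE hφ hvw (by linarith)]
    _ = φ u * φ v * (φ w * φ w) := mul_mul_mul_comm _ _ _ _

end ChordCharacter

theorem coe_add_coe_neg_sphere {V : Type*} [SeminormedAddCommGroup V] {r : ℝ}
    (x y : sphere (0 : V) r) : (x + (-y : sphere (0 : V) r) : V) = x - y := by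
  rw [coe_neg_sphere, ← sub_eq_add_neg]

theorem add_eq_add_of_sub_eq_sub {V : Type*} [SeminormedAddCommGroup V]
    {p q : V → sphere (0 : V) 1} (hpq : ∀ u, ‖u‖ ≤ 2 → (p u - q u : V) = u)
    (x x' : sphere (0 : V) 1) : (p (x - x') + x' : V) = x + q (x - x') :=
  sub_eq_sub_iff_add_eq_add.1 (hpq _ ((norm_sub_le _ _).trans (by
    rw [norm_eq_of_mem_sphere, norm_eq_of_mem_sphere]; norm_num)))

section ChordQuotient

variable {Ω Γ : Type*} [CommGroup Γ] {l : Filter Ω} {a : sphere (0 : E) 1 → Ω → Γ}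
  {p q : E → sphere (0 : E) 1}

theorem eventually_div_add (hE : 3 ≤ finrank ℝ E) (hpq : ∀ u, ‖u‖ ≤ 2 → (p u - q u : E) = u)
    (ha : ∀ x y x' y' : 𝕊, (x + y : E) = x' + y' →
      ∀ᶠ ω in l, a x ω * a y ω = a x' ω * a y' ω) {u v : E} (hu : ‖u‖ ≤ 1) (hv : ‖v‖ ≤ 1) :
    ∀ᶠ ω in l, a (p (u + v)) ω / a (q (u + v)) ω =
      a (p u) ω / a (q u) ω * (a (p v) ω / a (q v) ω) := by
  let A : 𝕊 → l.Germ Γ := fun x => (a x : l.Germ Γ)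
  have hA (x x' : 𝕊) : A (p (x - x')) / A (q (x - x')) = A x / A x' := by
    rw [div_eq_div_iff_mul_eq_mul]
    exact Germ.coe_eq.2 (ha _ _ _ _ (add_eq_add_of_sub_eq_sub hpq x x'))
  exact Germ.coe_eq.1 (map_add_of_map_sphere_sub (φ := fun u => A (p u) / A (q u)) hE hA hu hv)

theorem eventually_div_add_sub (hE : 3 ≤ finrank ℝ E)
    (hpq : ∀ u, ‖u‖ ≤ 2 → (p u - q u : E) = u)
    (ha : ∀ x y x' y' : 𝕊, (x + y : E) = x' + y' →
      ∀ᶠ ω in l, a x ω * a y ω = a x' ω * a y' ω) {s : E} (hs : ‖s‖ ≤ 1) {z z' : 𝕊}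
    (hz : dist z z' ≤ 1) :
    ∀ᶠ ω in l, a (p (s + (z - z'))) ω / a (q (s + (z - z'))) ω * a z' ω =
      a (p s) ω / a (q s) ω * a z ω := by
  rw [Subtype.dist_eq, dist_eq_norm] at hz
  filter_upwards [eventually_div_add hE hpq ha hs hz,
    ha _ _ _ _ (add_eq_add_of_sub_eq_sub hpq z z')] with ω h₁ h₂
  rw [h₁, mul_assoc, div_mul_eq_mul_div (a (p (z - z')) ω), h₂, mul_div_cancel_right]

end ChordQuotient

theorem exists_continuous_sphere_eq_cos_add_sin {n e : E} (hn : ‖n‖ = 1) (he : ‖e‖ = 1)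
    (hne : ⟪n, e⟫ = 0) :
    ∃ γ : ℝ → 𝕊, Continuous γ ∧ ∀ θ, (γ θ : E) = Real.cos θ • n + Real.sin θ • e := by
  have hmem (θ : ℝ) : Real.cos θ • n + Real.sin θ • e ∈ 𝕊 := by
    rw [mem_sphere_zero_iff_norm, ← sq_eq_sq₀ (norm_nonneg _) zero_le_one, norm_add_sq_real,
      inner_smul_left, inner_smul_right, hne, norm_smul, norm_smul, hn, he, mul_one, mul_one,
      Real.norm_eq_abs, Real.norm_eq_abs, sq_abs, sq_abs]
    linear_combination Real.cos_sq_add_sin_sq θ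
  exact ⟨fun θ => ⟨_, hmem θ⟩, by fun_prop, fun _ => rfl⟩

theorem norm_add_sq_sphere (x y : 𝕊) : ‖(x + y : E)‖ ^ 2 = 4 - dist x y ^ 2 := by
  have := parallelogram_law_with_norm ℝ (x : E) y
  rw [norm_eq_of_mem_sphere, norm_eq_of_mem_sphere] at this
  rw [Subtype.dist_eq, dist_eq_norm]
  linarith

theorem inner_add_sub_sphere (x y : 𝕊) : ⟪(x + y : E), x - y⟫ = 0 :=
  (real_inner_add_sub_eq_zero_iff _ _).2 (by rw [norm_eq_of_mem_sphere, norm_eq_of_mem_sphere])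

theorem exists_continuous_chord (hE : 3 ≤ finrank ℝ E) {x y : 𝕊} {n : E} (hn : ‖n‖ = 1)
    (hxy : (x + y : E) = ‖(x + y : E)‖ • n) (hort : ⟪n, (x - y : E)⟫ = 0) :
    ∃ a b : ℝ → 𝕊, Continuous a ∧ Continuous b ∧ a (dist x y) = x ∧ b (dist x y) = y ∧
      ∀ δ ∈ Icc 0 2, dist (a δ) (b δ) = δ ∧
        (a δ + b δ : E) = (2 * Real.cos (Real.arcsin (δ / 2))) • n := by
  obtain ⟨e, he, hne, -, hxye⟩ := exists_norm_eq_one_eq_norm_smul hE hort hort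
  obtain ⟨γ, hγ, hγeq⟩ := exists_continuous_sphere_eq_cos_add_sin hn he hne
  have hcos : Real.cos (Real.arcsin (dist x y / 2)) = ‖(x + y : E)‖ / 2 := by
    rw [Real.cos_arcsin, ← Real.sqrt_sq (div_nonneg (norm_nonneg (x + y : E)) zero_le_two),
      div_pow, div_pow, norm_add_sq_sphere]
    congr 1
    ring
  have hsin {δ : ℝ} (hδ : δ ∈ Icc 0 2) : Real.sin (Real.arcsin (δ / 2)) = δ / 2 :=
    Real.sin_arcsin (by linarith [hδ.1]) (by linarith [hδ.2])
  have hdist : dist x y ∈ Icc 0 2 := ⟨dist_nonneg, by nlinarith [norm_add_sq_sphere x y]⟩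
  refine ⟨fun δ => γ (Real.arcsin (δ / 2)), fun δ => γ (-Real.arcsin (δ / 2)),
    hγ.comp (by fun_prop), hγ.comp (by fun_prop), ?_, ?_, fun δ hδ => ⟨?_, ?_⟩⟩
  · ext1
    rw [hγeq, hcos, hsin hdist, Subtype.dist_eq, dist_eq_norm]
    linear_combination (norm := module) -(1 / 2 : ℝ) • hxy - (1 / 2 : ℝ) • hxye
  · ext1
    rw [hγeq, Real.cos_neg, Real.sin_neg, hcos, hsin hdist, Subtype.dist_eq, dist_eq_norm]
    linear_combination (norm := module) -(1 / 2 : ℝ) • hxy + (1 / 2 : ℝ) • hxye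
  · have hsub : (γ (Real.arcsin (δ / 2)) - γ (-Real.arcsin (δ / 2)) : E) = δ • e := by
      rw [hγeq, hγeq, Real.cos_neg, Real.sin_neg, hsin hδ]
      module
    rw [Subtype.dist_eq, dist_eq_norm, hsub, norm_smul, he, mul_one, Real.norm_of_nonneg hδ.1]
  · rw [hγeq, hγeq, Real.cos_neg, Real.sin_neg]
    module

theorem exists_continuous_rectangle (hE : 3 ≤ finrank ℝ E) {x y x' y' : 𝕊}
    (h : (x + y : E) = x' + y') :
    ∃ γ : ℝ → Fin 4 → 𝕊, Continuous γ ∧ γ (dist x y) = ![x, y, x', y'] ∧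
      ∀ δ ∈ Icc 0 2, dist (γ δ 0) (γ δ 1) = δ ∧ dist (γ δ 2) (γ δ 3) = δ ∧
        (γ δ 0 + γ δ 1 : E) = γ δ 2 + γ δ 3 := by
  obtain ⟨n, hn, hxyn, hxyn', hsum⟩ := exists_norm_eq_one_eq_norm_smul hE
    (u := (x - y : E)) (v := (x' - y' : E)) (q := (x + y : E))
    (by rw [real_inner_comm, inner_add_sub_sphere])
    (by rw [real_inner_comm, h, inner_add_sub_sphere])
  have hdist : dist x' y' = dist x y := by
    rw [← sq_eq_sq₀ dist_nonneg dist_nonneg]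
    linarith [norm_add_sq_sphere x y, norm_add_sq_sphere x' y', congrArg (‖·‖ ^ 2) h]
  obtain ⟨a, b, ha, hb, hax, hby, hab⟩ :=
    exists_continuous_chord hE hn hsum (by rw [real_inner_comm, hxyn])
  obtain ⟨a', b', ha', hb', hax', hby', hab'⟩ :=
    exists_continuous_chord hE hn (h ▸ hsum) (by rw [real_inner_comm, hxyn'])
  rw [hdist] at hax' hby'
  refine ⟨fun δ => ![a δ, b δ, a' δ, b' δ], ?_, by simp only [hax, hby, hax', hby'],
    fun δ hδ => ⟨(hab δ hδ).1, (hab' δ hδ).1, (hab δ hδ).2.trans (hab' δ hδ).2.symm⟩⟩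
  exact continuous_pi fun i => by fin_cases i <;> assumption

/-- The map between unit spheres induced by a linear isometry. -/
def sphereMap {F : Type*} [NormedAddCommGroup F] [InnerProductSpace ℝ F] (A : E ≃ₗᵢ[ℝ] F)
    (x : 𝕊) : sphere (0 : F) 1 :=
  ⟨A x, by simp⟩

theorem continuous_sphereMap {F : Type*} [NormedAddCommGroup F] [InnerProductSpace ℝ F]
    (A : E ≃ₗᵢ[ℝ] F) : Continuous (sphereMap A) :=
  (A.continuous.comp continuous_subtype_val).subtype_mk _

variable [FiniteDimensional ℝ E]

local notation "G" => unitary (E →L[ℝ] E)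

instance continuousStar_clm : ContinuousStar (E →L[ℝ] E) :=
  ⟨ContinuousLinearMap.adjoint.continuous⟩

instance compactSpace_unitary : CompactSpace G := by
  refine isCompact_iff_compactSpace.1 (Metric.isCompact_of_isClosed_isBounded isClosed_unitary ?_)
  refine (Metric.isBounded_iff_subset_closedBall 0).2 ⟨1, fun u hu => ?_⟩
  rw [mem_closedBall_zero_iff]
  exact ContinuousLinearMap.opNorm_le_bound _ zero_le_one fun x => by
    rw [u.norm_map_of_mem_unitary hu, one_mul]

/-- The action on the unit sphere of the orthogonal group of `E`, encoded as the unitary group of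
`E →L[ℝ] E`. -/
noncomputable instance mulAction_sphere : MulAction G 𝕊 where
  smul g x := sphereMap (Unitary.linearIsometryEquiv g) x
  one_smul _ := rfl
  mul_smul _ _ _ := rfl

theorem coe_smul_sphere (g : G) (x : 𝕊) : ((g • x : 𝕊) : E) = g • (x : E) := rfl

instance continuousSMul_sphere : ContinuousSMul G 𝕊 :=
  ⟨Continuous.subtype_mk ((continuous_subtype_val.comp continuous_fst).clm_apply
    (continuous_subtype_val.comp continuous_snd)) _⟩

theorem exists_unitary_smul_eq_of_norm_eq {x y : E} (h : ‖x‖ = ‖y‖) :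
    ∃ g : G, g • x = y ∧ ∀ z : E, ⟪x - y, z⟫ = 0 → g • z = z := by
  refine ⟨Unitary.linearIsometryEquiv.symm ((ℝ ∙ (x - y))ᗮ.reflection),
    Submodule.reflection_sub h, fun z hz => ?_⟩
  exact Submodule.reflection_mem_subspace_eq_self
    (Submodule.mem_orthogonal_singleton_iff_inner_right.2 hz)

/-- One reflection takes `x` to `x'`, and a second one takes the image of `y` to `y'` while fixing
`x'`, by the equality of distances. -/
theorem exists_unitary_smul_eq_smul_eq {x y x' y' : 𝕊} (h : dist x y = dist x' y') :
    ∃ g : G, g • x = x' ∧ g • y = y' := by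
  obtain ⟨g₁, hg₁, -⟩ := exists_unitary_smul_eq_of_norm_eq
    ((norm_eq_of_mem_sphere x).trans (norm_eq_of_mem_sphere x').symm)
  have hx : g₁ • x = x' := Subtype.ext hg₁
  have hdist : dist x' (g₁ • y) = dist x' y' := by
    rw [← h, ← hx]
    exact (Unitary.linearIsometryEquiv g₁).dist_map _ _
  have horth : ⟪((g₁ • y : 𝕊) : E) - y', (x' : E)⟫ = 0 := by
    rw [Subtype.dist_eq, Subtype.dist_eq, dist_eq_norm, dist_eq_norm] at hdist
    have h₁ := norm_sub_sq_real (x' : E) (g₁ • y : 𝕊)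
    have h₂ := norm_sub_sq_real (x' : E) y'
    rw [hdist, norm_eq_of_mem_sphere (g₁ • y)] at h₁
    rw [norm_eq_of_mem_sphere y'] at h₂
    rw [inner_sub_left, real_inner_comm, real_inner_comm (x' : E) y']
    linarith
  obtain ⟨g₂, hg₂, hfix⟩ := exists_unitary_smul_eq_of_norm_eq
    ((norm_eq_of_mem_sphere (g₁ • y)).trans (norm_eq_of_mem_sphere y').symm)
  exact ⟨g₂ * g₁, by rw [mul_smul, hx]; exact Subtype.ext (hfix _ horth),
    by rw [mul_smul]; exact Subtype.ext hg₂⟩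

instance isPretransitive_sphere : MulAction.IsPretransitive G 𝕊 :=
  ⟨fun x y => (exists_unitary_smul_eq_smul_eq (by rw [dist_self, dist_self])).imp fun _ h => h.1⟩

theorem ae_smul_mul_smul_eq_of_dist_eq {ν : Measure G} [ν.IsMulRightInvariant] {f : 𝕊 → ℂ}
    {H : E → ℂ} {x y x' y' : 𝕊} (hdist : dist x y = dist x' y')
    (h : ∀ᵐ g : G ∂ν, f (g • x) * f (g • y) = H (g • (x + y : E))) :
    ∀ᵐ g : G ∂ν, f (g • x') * f (g • y') = H (g • (x' + y' : E)) := by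
  obtain ⟨k, rfl, rfl⟩ := exists_unitary_smul_eq_smul_eq hdist
  filter_upwards [ae_mul_right h k] with g hg
  simpa only [mul_smul, smul_add, coe_smul_sphere] using hg

variable [MeasurableSpace E] [BorelSpace E]

local notation "σ" => Measure.toSphere (volume : Measure E)

theorem measurePreserving_sphereMap {F : Type*} [NormedAddCommGroup F] [InnerProductSpace ℝ F]
    [FiniteDimensional ℝ F] [MeasurableSpace F] [BorelSpace F] (A : E ≃ₗᵢ[ℝ] F) :
    MeasurePreserving (sphereMap A) σ (volume : Measure F).toSphere := by
  have hA := (continuous_sphereMap A).measurable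
  refine ⟨hA, Measure.ext fun s hs => ?_⟩
  have hcone : Ioo (0 : ℝ) 1 • ((↑) '' (sphereMap A ⁻¹' s) : Set E)
      = A ⁻¹' (Ioo (0 : ℝ) 1 • ((↑) '' s : Set F)) := by
    ext x
    simp only [Set.mem_smul, mem_preimage]
    constructor
    · rintro ⟨r, hr, _, ⟨y, hy, rfl⟩, rfl⟩
      exact ⟨r, hr, _, ⟨sphereMap A y, hy, rfl⟩, (map_smul A r (y : E)).symm⟩
    · rintro ⟨r, hr, _, ⟨y, hy, rfl⟩, h⟩
      have hy' : sphereMap A (sphereMap A.symm y) = y := Subtype.ext (A.apply_symm_apply y)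
      refine ⟨r, hr, _, ⟨sphereMap A.symm y, by rwa [mem_preimage, hy'], rfl⟩, A.injective ?_⟩
      exact (map_smul A r _).trans ((congrArg (r • ·) (A.apply_symm_apply y)).trans h)
  have hvol : volume (A ⁻¹' (Ioo (0 : ℝ) 1 • ((↑) '' s : Set F))) =
      volume (Ioo (0 : ℝ) 1 • ((↑) '' s : Set F)) :=
    A.measurePreserving.measure_preimage_equiv (f := A.toHomeomorph.toMeasurableEquiv) _
  rw [Measure.map_apply hA hs, Measure.toSphere_apply' _ hs, Measure.toSphere_apply' _ (hA hs),
    hcone, hvol, A.toLinearEquiv.finrank_eq]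

instance smulInvariantMeasure_sphere : SMulInvariantMeasure G 𝕊 σ :=
  ⟨fun g _ hs => (measurePreserving_sphereMap
    (Unitary.linearIsometryEquiv g)).measure_preimage hs.nullMeasurableSet⟩

instance smulInvariantMeasure_sphere_prod : SMulInvariantMeasure G (𝕊 × 𝕊) ((σ).prod σ) :=
  smulInvariantMeasure_prod _ _

theorem exists_measurable_norm_eq_one_inner_eq_zero (hE : 2 ≤ finrank ℝ E) :
    ∃ n : E → E, Measurable n ∧ ∀ u, ‖n u‖ = 1 ∧ ⟪u, n u⟫ = 0 := by
  classical
  set b := stdOrthonormalBasis ℝ E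
  set i : Fin (finrank ℝ E) := ⟨0, by omega⟩
  set j : Fin (finrank ℝ E) := ⟨1, by omega⟩
  have hij : i ≠ j := by simp [i, j]
  have hbij : ⟪b i, b j⟫ = 0 := b.orthonormal.inner_eq_zero hij
  set J : E → E := fun u => ⟪b j, u⟫ • b i - ⟪b i, u⟫ • b j with hJ
  have hJm : Measurable J := by fun_prop
  have hJu (u : E) : ⟪u, J u⟫ = 0 := by
    rw [hJ, inner_sub_right, inner_smul_right, inner_smul_right, real_inner_comm u,
      real_inner_comm u]
    ring
  have hbu {u : E} (h : J u = 0) : ⟪u, b i⟫ = 0 := by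
    simpa [hJ, inner_sub_right, inner_smul_right, real_inner_comm (b i) (b j), hbij,
      b.orthonormal.1 j, real_inner_comm u] using congrArg (⟪b j, ·⟫) h
  refine ⟨fun u => if J u = 0 then b i else ‖J u‖⁻¹ • J u,
    .ite (hJm (measurableSet_singleton 0)) measurable_const (hJm.norm.inv.smul hJm), fun u => ?_⟩
  dsimp only
  split_ifs with h
  · exact ⟨b.orthonormal.1 i, hbu h⟩
  · exact ⟨norm_smul_inv_norm h, by rw [inner_smul_right, hJu, mul_zero]⟩

theorem exists_measurable_sphere_sub_eq (hE : 2 ≤ finrank ℝ E) :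
    ∃ p q : E → 𝕊, Measurable p ∧ Measurable q ∧ ∀ u, ‖u‖ ≤ 2 → (p u - q u : E) = u := by
  obtain ⟨n, hn, hnu⟩ := exists_measurable_norm_eq_one_inner_eq_zero hE
  set w : ℝ → E → E := fun ε u => if ‖u‖ ≤ 2 then ε • u + √(1 - ‖u‖ ^ 2 / 4) • n u else n 0
  have hwm (ε : ℝ) : Measurable (w ε) :=
    .ite (measurableSet_le (by fun_prop) measurable_const) (by fun_prop) measurable_const
  have hw {ε : ℝ} (hε : ε ^ 2 = 1 / 4) (u : E) : w ε u ∈ 𝕊 := by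
    rw [mem_sphere_zero_iff_norm]
    by_cases hu : ‖u‖ ≤ 2
    · rw [← sq_eq_sq₀ (norm_nonneg _) zero_le_one]
      simp only [w, if_pos hu]
      rw [norm_add_sq_real, norm_smul, norm_smul, (hnu u).1, inner_smul_left, inner_smul_right,
        (hnu u).2, mul_one, mul_pow, Real.norm_eq_abs, Real.norm_eq_abs, sq_abs, sq_abs,
        Real.sq_sqrt (by nlinarith [norm_nonneg u])]
      linear_combination ‖u‖ ^ 2 * hε
    · simp only [w, if_neg hu, (hnu 0).1]
  refine ⟨fun u => ⟨w (1 / 2) u, hw (by norm_num) u⟩, fun u => ⟨w (-1 / 2) u, hw (by norm_num) u⟩,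
    (hwm _).subtype_mk, (hwm _).subtype_mk, fun u hu => ?_⟩
  simp only [w, if_pos hu]
  module

/-- Translating `P` by `z - z'` multiplies it by `F z / F z'`, and near the origin `P` is an
exponential, so `F` divided by that exponential is locally constant on a connected sphere. -/
theorem exists_ae_eq_const_mul_exp_of_translation (hE : 2 ≤ finrank ℝ E) {F : 𝕊 → ℂ}
    {P χ : E → ℂ} (hP : Measurable P) (hχ : Measurable χ) {r : ℝ} (hr : 0 < r)
    (h : ∀ᵐ z : E × E, z.1 ∈ ball 0 r → z.2 ∈ ball 0 r → P (z.1 + z.2) = P z.1 * χ z.2)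
    (hP0 : ∀ᵐ s, s ∈ ball 0 (2 * r) → P s ≠ 0) (hF : ¬ ∀ᵐ z ∂σ, F z = 0)
    (htr : ∀ᵐ z' : 𝕊 ∂σ, ∀ᵐ z : 𝕊 ∂σ, dist z z' < r →
      ∀ᵐ s, s ∈ ball 0 r → P (s + (z - z')) * F z' = P s * F z) :
    ∃ c ≠ 0, ∃ l : E →L[ℝ] ℂ, ∀ᵐ z : 𝕊 ∂σ, F z = c * Complex.exp (l z) := by
  obtain ⟨c₀, hc₀, l, hl⟩ := exists_ae_eq_const_mul_exp_of_local_pexider hP hχ hr h hP0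
  have := connectedSpace_sphere hE
  obtain ⟨c, hc⟩ := ae_eq_const_of_ae_dist_lt (u := fun z : 𝕊 => F z * Complex.exp (-l z)) σ
    (show 0 < r / 8 by positivity) (htr.mono fun z' hz' => hz'.mono fun z hz hdist => by
      refine mul_exp_neg_eq_of_ae_translate (μ := volume) (P := P) (δ := r / 8) hc₀ ?_ ?_ ?_
      · exact hl.mono fun s hs hsr => hs (ball_subset_ball (by linarith) hsr)
      · rwa [← dist_eq_norm]
      · exact (hz (by linarith)).mono fun s hs hsr => hs (ball_subset_ball (by linarith) hsr))
  have hFexp : ∀ᵐ z : 𝕊 ∂σ, F z = c * Complex.exp (l z) := hc.mono fun z hz => by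
    rw [← hz, mul_assoc, ← Complex.exp_add, neg_add_cancel, Complex.exp_zero, mul_one]
  refine ⟨c, fun hc0 => hF (hFexp.mono fun z hz => ?_), l, hFexp⟩
  rw [hz, hc0, zero_mul]

section HaarRotation

variable {ν : Measure (unitary (E →L[ℝ] E))} [IsFiniteMeasure ν] {f : sphere (0 : E) 1 → ℂ}
  {H : E → ℂ}

theorem exists_seq_ae_smul_mul_smul_eq (hH : ∀ᵐ z ∂(σ).prod σ, f z.1 * f z.2 = H (z.1 + z.2))
    (x y : 𝕊) : ∃ z : ℕ → 𝕊 × 𝕊, Tendsto z atTop (𝓝 (x, y)) ∧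
      ∀ n, ∀ᵐ g : G ∂ν, f (g • (z n).1) * f (g • (z n).2) = H (g • ((z n).1 + (z n).2 : E)) := by
  have hdense := Measure.dense_of_ae (ae_ae_smul (ν := ν) hH)
  obtain ⟨z, hz, hlim⟩ := mem_closure_iff_seq_limit.1 (hdense (x, y))
  refine ⟨z, hlim, fun n => ?_⟩
  filter_upwards [show ∀ᵐ g : G ∂ν, _ from hz n] with g hg
  rw [smul_add]
  exact hg

variable [ν.IsMulRightInvariant] [ν.InnerRegularCompactLTTop]

/-- A pair `(a, b)` is good if `f (g • a) * f (g • b) = H (g • a + g • b)` for almost every `g`;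
this depends only on `dist a b`, and almost every pair is good. So `(x, y)` and `(x', y')` are
limits of good pairs with equal sums. -/
theorem ae_smul_mul_smul_eq_of_add_eq (hE : 3 ≤ finrank ℝ E) (hf : Measurable f)
    (hH : ∀ᵐ z ∂(σ).prod σ, f z.1 * f z.2 = H (z.1 + z.2)) {x y x' y' : 𝕊}
    (h : (x + y : E) = x' + y') :
    ∀ᵐ g : G ∂ν, f (g • x) * f (g • y) = f (g • x') * f (g • y') := by
  obtain ⟨z, hz, hgood⟩ := exists_seq_ae_smul_mul_smul_eq (ν := ν) hH x y
  obtain ⟨γ, hγ, hγ₀, hγδ⟩ := exists_continuous_rectangle hE h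
  have hmem (a b : 𝕊) : dist a b ∈ Icc 0 2 :=
    ⟨dist_nonneg, by nlinarith [norm_add_sq_sphere a b]⟩
  have hlim : Tendsto (fun n => γ (dist (z n).1 (z n).2)) atTop (𝓝 ![x, y, x', y']) :=
    hγ₀ ▸ (hγ.tendsto _).comp ((continuous_dist.tendsto (x, y)).comp hz)
  refine ae_smul_mem_of_tendsto (C := {w | w 0 * w 1 = w 2 * w 3}) hf.stronglyMeasurable hlim
    (isClosed_eq (by fun_prop) (by fun_prop)) fun n => ?_
  obtain ⟨h₁, h₂, h₃⟩ := hγδ _ (hmem (z n).1 (z n).2)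
  filter_upwards [ae_smul_mul_smul_eq_of_dist_eq h₁.symm (hgood n),
    ae_smul_mul_smul_eq_of_dist_eq h₂.symm (hgood n)] with g hg₁ hg₂
  exact hg₁.trans (h₃ ▸ hg₂.symm)

/-- If the lines from `c` to `a` and `b` are orthogonal, then `c` and `a + b - c` complete `a`, `b`
to a rectangle inscribed in the sphere. -/
theorem ae_smul_ne_zero_of_ne (hE : 3 ≤ finrank ℝ E) (hf : Measurable f)
    (hH : ∀ᵐ z ∂(σ).prod σ, f z.1 * f z.2 = H (z.1 + z.2)) {x y : 𝕊} (hxy : x ≠ y) (z : 𝕊) :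
    ∀ᵐ g : G ∂ν, f (g • x) ≠ 0 → f (g • y) ≠ 0 → f (g • z) ≠ 0 := by
  have hZ : IsRightAngleClosed
      {z : 𝕊 | ∀ᵐ g : G ∂ν, f (g • x) ≠ 0 → f (g • y) ≠ 0 → f (g • z) ≠ 0} := by
    intro a ha b hb c hc
    filter_upwards [show ∀ᵐ g : G ∂ν, _ from ha, show ∀ᵐ g : G ∂ν, _ from hb,
      ae_smul_mul_smul_eq_of_add_eq hE hf hH (x := a) (y := b) (x' := c)
        (y' := ⟨_, add_sub_mem_sphere hc⟩) (add_sub_cancel _ _).symm] with g hga hgb hg hx hy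
    exact left_ne_zero_of_mul (hg ▸ mul_ne_zero (hga hx hy) (hgb hx hy))
  exact eq_univ_iff_forall.1 (hZ.eq_univ hE (a := x) (b := y)
    (show ∀ᵐ g : G ∂ν, _ from .of_forall fun _ hx _ => hx)
    (show ∀ᵐ g : G ∂ν, _ from .of_forall fun _ _ hy => hy) hxy) z

theorem ae_smul_ne_zero_of_smul_ne_zero (hE : 3 ≤ finrank ℝ E) (hf : Measurable f)
    (hH : ∀ᵐ z ∂(σ).prod σ, f z.1 * f z.2 = H (z.1 + z.2)) (x z : 𝕊) :
    ∀ᵐ g : G ∂ν, f (g • x) ≠ 0 → f (g • z) ≠ 0 := by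
  have : Nontrivial 𝕊 := ⟨x, -x, ne_neg_of_mem_unit_sphere ℝ x⟩
  have := connectedSpace_sphere (E := E) (by omega)
  have hx : x ∈ closure {x}ᶜ := mem_closure_iff_nhdsWithin_neBot.2 inferInstance
  obtain ⟨y, hy, hlim⟩ := mem_closure_iff_seq_limit.1 hx
  obtain ⟨φ, -, hφ⟩ := exists_strictMono_ae_tendsto_smul (ν := ν) hf.stronglyMeasurable hlim
  filter_upwards [hφ, ae_all_iff.2 fun n =>
    ae_smul_ne_zero_of_ne (ν := ν) hE hf hH (Ne.symm (hy n)) z] with g hg hne hgx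
  obtain ⟨n, hn⟩ := (hg.eventually_ne hgx).exists
  exact hne (φ n) hgx hn

theorem ae_ne_zero_of_ae_mul_eq [NeZero ν] (hE : 3 ≤ finrank ℝ E) (hf : Measurable f)
    (hH : ∀ᵐ z ∂(σ).prod σ, f z.1 * f z.2 = H (z.1 + z.2)) (hf0 : ¬ ∀ᵐ z ∂σ, f z = 0) :
    ∀ᵐ z ∂σ, f z ≠ 0 := by
  obtain ⟨x⟩ := (connectedSpace_sphere (E := E) (by omega)).toNonempty
  have hfx : ∃ᵐ g : G ∂ν, f (g • x) ≠ 0 :=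
    not_eventually.1 fun h => hf0 (ae_of_ae_smul (hf (measurableSet_singleton 0)) h)
  have hfz : ∀ᵐ g : G ∂ν, ∀ᵐ z ∂σ, f (g • x) ≠ 0 → f (g • z) ≠ 0 := by
    refine (Measure.ae_ae_comm (p := fun z (g : G) => f (g • x) ≠ 0 → f (g • z) ≠ 0) ?_).1
      (.of_forall fun z => ae_smul_ne_zero_of_smul_ne_zero hE hf hH x z)
    have h0 : MeasurableSet {z : 𝕊 | f z ≠ 0} := (hf (measurableSet_singleton 0)).compl
    exact ((measurable_snd.smul_const x) h0).imp ((measurable_snd.smul measurable_fst) h0)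
  obtain ⟨g, hgx, hg⟩ := (hfx.and_eventually hfz).exists
  exact ae_of_ae_comp_smul g (hg.mono fun z hz => hz hgx)

/-- The ratio `f (g • x) / f (g • y)` over a chord `s = x - y` of the sphere with chosen endpoints
`x = p s` and `y = q s`; for almost every `g` it is locally multiplicative in `s`. -/
noncomputable def chordRatio (f : 𝕊 → ℂ) (p q : E → 𝕊) (g : G) (s : E) : ℂ :=
  f (g • p s) / f (g • q s)

variable {p q : E → sphere (0 : E) 1}

theorem measurable_chordRatio (hf : Measurable f) (hp : Measurable p) (hq : Measurable q) :
    Measurable fun z : E × G => chordRatio f p q z.2 z.1 := by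
  have hfm : Measurable fun z : 𝕊 × G => f (z.2 • z.1) :=
    hf.comp (measurable_snd.smul measurable_fst)
  exact (hfm.comp (hp.prodMap measurable_id)).div (hfm.comp (hq.prodMap measurable_id))

theorem ae_chordRatio_add (hE : 3 ≤ finrank ℝ E) (hf : Measurable f) (hf0 : ∀ z, f z ≠ 0)
    (hH : ∀ᵐ z ∂(σ).prod σ, f z.1 * f z.2 = H (z.1 + z.2))
    (hpq : ∀ u, ‖u‖ ≤ 2 → (p u - q u : E) = u) {u v : E} (hu : ‖u‖ ≤ 1) (hv : ‖v‖ ≤ 1) :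
    ∀ᵐ g : G ∂ν, chordRatio f p q g (u + v) = chordRatio f p q g u * chordRatio f p q g v := by
  filter_upwards [eventually_div_add (a := fun x (g : G) => Units.mk0 (f (g • x)) (hf0 _)) hE hpq
    (fun x y x' y' h => (ae_smul_mul_smul_eq_of_add_eq (ν := ν) hE hf hH h).mono
      fun g hg => Units.ext hg) hu hv] with g hg
  simpa [chordRatio] using congrArg Units.val hg

theorem ae_chordRatio_add_sub (hE : 3 ≤ finrank ℝ E) (hf : Measurable f) (hf0 : ∀ z, f z ≠ 0)
    (hH : ∀ᵐ z ∂(σ).prod σ, f z.1 * f z.2 = H (z.1 + z.2))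
    (hpq : ∀ u, ‖u‖ ≤ 2 → (p u - q u : E) = u) {s : E} (hs : ‖s‖ ≤ 1) {z z' : 𝕊}
    (hz : dist z z' ≤ 1) :
    ∀ᵐ g : G ∂ν, chordRatio f p q g (s + (z - z')) * f (g • z') =
      chordRatio f p q g s * f (g • z) := by
  filter_upwards [eventually_div_add_sub (a := fun x (g : G) => Units.mk0 (f (g • x)) (hf0 _)) hE
    hpq (fun x y x' y' h => (ae_smul_mul_smul_eq_of_add_eq (ν := ν) hE hf hH h).mono
      fun g hg => Units.ext hg) hs hz] with g hg
  simpa [chordRatio] using congrArg Units.val hg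

theorem ae_ae_chordRatio_add (hE : 3 ≤ finrank ℝ E) (hf : Measurable f) (hf0 : ∀ z, f z ≠ 0)
    (hH : ∀ᵐ z ∂(σ).prod σ, f z.1 * f z.2 = H (z.1 + z.2)) (hp : Measurable p)
    (hq : Measurable q) (hpq : ∀ u, ‖u‖ ≤ 2 → (p u - q u : E) = u) :
    ∀ᵐ g : G ∂ν, ∀ᵐ w : E × E, w.1 ∈ ball 0 1 → w.2 ∈ ball 0 1 →
      chordRatio f p q g (w.1 + w.2) = chordRatio f p q g w.1 * chordRatio f p q g w.2 := by
  have hψ := measurable_chordRatio hf hp hq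
  have hψ' {c : (E × E) × G → E} (hc : Measurable c) :
      Measurable fun y => chordRatio f p q y.2 (c y) := hψ.comp (hc.prodMk measurable_snd)
  refine (Measure.ae_ae_comm ?_).1 (.of_forall fun w : E × E => ?_)
  · refine .imp (measurable_fst.fst measurableSet_ball)
      (.imp (measurable_fst.snd measurableSet_ball)
        (measurableSet_eq_fun (hψ' ?_) (.mul (hψ' ?_) (hψ' ?_)))) <;> fun_prop
  · by_cases hw : w.1 ∈ ball 0 1 ∧ w.2 ∈ ball 0 1
    · filter_upwards [ae_chordRatio_add hE hf hf0 hH hpq (mem_ball_zero_iff.1 hw.1).le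
        (mem_ball_zero_iff.1 hw.2).le] with g hg _ _ using hg
    · exact .of_forall fun g h₁ h₂ => absurd ⟨h₁, h₂⟩ hw

theorem ae_ae_chordRatio_add_sub (hE : 3 ≤ finrank ℝ E) (hf : Measurable f)
    (hf0 : ∀ z, f z ≠ 0) (hH : ∀ᵐ z ∂(σ).prod σ, f z.1 * f z.2 = H (z.1 + z.2))
    (hp : Measurable p) (hq : Measurable q) (hpq : ∀ u, ‖u‖ ≤ 2 → (p u - q u : E) = u) :
    ∀ᵐ g : G ∂ν, ∀ᵐ z' : 𝕊 ∂σ, ∀ᵐ z : 𝕊 ∂σ, dist z z' < 1 → ∀ᵐ s, s ∈ ball 0 1 →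
      chordRatio f p q g (s + (z - z')) * f (g • z') = chordRatio f p q g s * f (g • z) := by
  have hψ := measurable_chordRatio hf hp hq
  have hψ' {c : (𝕊 × 𝕊 × E) × G → E} (hc : Measurable c) :
      Measurable fun y => chordRatio f p q y.2 (c y) := hψ.comp (hc.prodMk measurable_snd)
  have hf' {c : (𝕊 × 𝕊 × E) × G → 𝕊} (hc : Measurable c) :
      Measurable fun y => f (y.2 • c y) := hf.comp (measurable_snd.smul hc)
  have : SFinite ((σ).prod (volume : Measure E)) := Measure.prod.instSFinite
  have h : ∀ᵐ g : G ∂ν, ∀ᵐ w ∂(σ).prod ((σ).prod (volume : Measure E)),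
      dist w.2.1 w.1 < 1 → w.2.2 ∈ ball 0 1 →
        chordRatio f p q g (w.2.2 + (w.2.1 - w.1)) * f (g • w.1) =
          chordRatio f p q g w.2.2 * f (g • w.2.1) := by
    refine (Measure.ae_ae_comm ?_).1 (.of_forall fun w : 𝕊 × 𝕊 × E => ?_)
    · refine .imp (measurableSet_lt (by fun_prop) measurable_const)
        (.imp (measurable_fst.snd.snd measurableSet_ball) (measurableSet_eq_fun
          (.mul (hψ' ?_) (hf' ?_)) (.mul (hψ' ?_) (hf' ?_)))) <;> fun_prop
    · by_cases hw : dist w.2.1 w.1 < 1 ∧ w.2.2 ∈ ball 0 1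
      · filter_upwards [ae_chordRatio_add_sub hE hf hf0 hH hpq (mem_ball_zero_iff.1 hw.2).le
          hw.1.le] with g hg _ _ using hg
      · exact .of_forall fun g h₁ h₂ => absurd ⟨h₁, h₂⟩ hw
  filter_upwards [h] with g hg
  filter_upwards [Measure.ae_ae_of_ae_prod hg] with z' hz'
  filter_upwards [Measure.ae_ae_of_ae_prod hz'] with z hz hdist
  exact hz.mono fun s hs => hs hdist

theorem exists_ae_eq_const_mul_exp_of_ne_zero [NeZero ν] (hE : 3 ≤ finrank ℝ E)
    (hf : Measurable f) (hf0 : ∀ z, f z ≠ 0)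
    (hH : ∀ᵐ z ∂(σ).prod σ, f z.1 * f z.2 = H (z.1 + z.2)) :
    ∃ c ≠ 0, ∃ l : E →L[ℝ] ℂ, ∀ᵐ z ∂σ, f z = c * Complex.exp (l z) := by
  have : Nontrivial E := nontrivial_of_finrank_pos (R := ℝ) (by omega)
  have hσ : (ae σ).NeBot := ae_neBot.2 (Measure.toSphere_ne_zero _)
  obtain ⟨p, q, hp, hq, hpq⟩ := exists_measurable_sphere_sub_eq (E := E) (by omega)
  obtain ⟨g, hadd, htr⟩ := ((ae_ae_chordRatio_add (ν := ν) hE hf hf0 hH hp hq hpq).and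
    (ae_ae_chordRatio_add_sub hE hf hf0 hH hp hq hpq)).exists
  have hψ : Measurable (chordRatio f p q g) :=
    (measurable_chordRatio hf hp hq).comp measurable_prodMk_right
  obtain ⟨c, hc, l, hl⟩ := exists_ae_eq_const_mul_exp_of_translation (by omega)
    (F := fun z => f (g • z)) hψ hψ one_pos hadd
    (.of_forall fun s _ => div_ne_zero (hf0 _) (hf0 _))
    (fun h => (@Eventually.exists _ _ _ hσ h).elim fun z hz => hf0 _ hz) htr
  refine ⟨c, hc, l.comp ((g⁻¹ : G) : E →L[ℝ] E), ae_of_ae_comp_smul g (hl.mono fun z hz => ?_)⟩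
  have hinv : ((g⁻¹ : G) : E →L[ℝ] E) (g • z : 𝕊) = z := inv_smul_smul g (z : E)
  rw [hz, ContinuousLinearMap.comp_apply, hinv]

end HaarRotation

theorem exists_ae_eq_const_mul_exp_of_ae_mul_eq (hE : 3 ≤ finrank ℝ E) {F : 𝕊 → ℂ} {H : E → ℂ}
    (hF : AEMeasurable F σ) (hF0 : ¬ ∀ᵐ z ∂σ, F z = 0)
    (hH : ∀ᵐ z ∂(σ).prod σ, F z.1 * F z.2 = H (z.1 + z.2)) :
    ∃ c ≠ 0, ∃ l : E →L[ℝ] ℂ, ∀ᵐ z ∂σ, F z = c * Complex.exp (l z) := by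
  let ν : Measure G := (Measure.haar : Measure G).inv
  have : IsFiniteMeasure ν := inferInstanceAs (IsFiniteMeasure (Measure.map Inv.inv _))
  have : NeZero ν := ⟨fun h => NeZero.ne (Measure.haar : Measure G) (by
    rw [← Measure.inv_inv Measure.haar, show Measure.inv _ = 0 from h, Measure.inv_def,
      Measure.map_zero])⟩
  have heq (f : 𝕊 → ℂ) (hf : f =ᵐ[σ] F) : ∀ᵐ z ∂(σ).prod σ, f z.1 * f z.2 = H (z.1 + z.2) := by
    filter_upwards [hH, Measure.quasiMeasurePreserving_fst.ae hf,
      Measure.quasiMeasurePreserving_snd.ae hf] with z hz h₁ h₂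
    rw [h₁, h₂, hz]
  have hne : ∀ᵐ z ∂σ, F z ≠ 0 := by
    have hf := hF.ae_eq_mk.symm
    filter_upwards [hf, ae_ne_zero_of_ae_mul_eq (ν := ν) hE hF.measurable_mk (heq _ hf)
      fun h => hF0 (hf.symm.trans h)] with z hz h
    rwa [← hz]
  set f : 𝕊 → ℂ := fun z => if hF.mk F z = 0 then 1 else hF.mk F z
  have hfm : Measurable f := .ite (hF.measurable_mk (measurableSet_singleton 0)) measurable_const
    hF.measurable_mk
  have hfF : f =ᵐ[σ] F := by
    filter_upwards [hF.ae_eq_mk, hne] with z hz h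
    rw [hz] at h ⊢
    exact if_neg h
  obtain ⟨c, hc, l, hl⟩ := exists_ae_eq_const_mul_exp_of_ne_zero (ν := ν) hE hfm
    (fun z => by dsimp only [f]; split_ifs with h; exacts [one_ne_zero, h]) (heq f hfF)
  exact ⟨c, hc, l, hfF.symm.trans hl⟩

end Sphere

section Plane

variable {E : Type*} [NormedAddCommGroup E] [InnerProductSpace ℝ E]

local notation "𝕊" => sphere (0 : E) 1

variable (A : ℂ ≃ₗᵢ[ℝ] E)

/-- The point of the unit circle of a plane at angle `θ`, the plane being identified with `ℂ` by
the isometry `A`. -/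
noncomputable def unitPoint (θ : ℝ) : 𝕊 :=
  sphereMap A ⟨Complex.exp (θ * Complex.I), by simp⟩

theorem coe_unitPoint (θ : ℝ) : (unitPoint A θ : E) = A (Complex.exp (θ * Complex.I)) := rfl

theorem continuous_unitPoint : Continuous (unitPoint A) :=
  (continuous_sphereMap A).comp (Continuous.subtype_mk (by fun_prop) _)

theorem surjective_unitPoint : (unitPoint A).Surjective := fun x => by
  have hx : ‖A.symm (x : E)‖ = 1 := by simp
  refine ⟨Complex.arg (A.symm (x : E)), Subtype.ext ?_⟩
  have h := Complex.norm_mul_exp_arg_mul_I (A.symm (x : E))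
  rw [hx, Complex.ofReal_one, one_mul] at h
  exact (congrArg A h).trans (A.apply_symm_apply _)

theorem hasStrictDerivAt_coe_unitPoint (θ : ℝ) :
    HasStrictDerivAt (fun t => (unitPoint A t : E))
      (A (Complex.exp (θ * Complex.I) * Complex.I)) θ := by
  have h : HasStrictDerivAt (fun t : ℝ => Complex.exp (t * Complex.I))
      (Complex.exp (θ * Complex.I) * Complex.I) θ := by
    simpa using ((Complex.ofRealCLM.hasStrictDerivAt (x := θ)).mul_const Complex.I).cexp
  exact A.toContinuousLinearEquiv.hasStrictFDerivAt.comp_hasStrictDerivAt θ h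

theorem linearIndependent_unitPoint_deriv {r : ℝ} (hr : r ≠ 0) (θ : ℝ) :
    LinearIndependent ℝ
      ![(unitPoint A θ : E), r • A (Complex.exp (θ * Complex.I) * Complex.I)] := by
  refine LinearIndependent.pair_iff.2 fun s t h => ?_
  have hA : A (Complex.exp (θ * Complex.I) * (s + (t * r : ℝ) * Complex.I)) = 0 := by
    rw [← h, smul_smul, coe_unitPoint, ← map_smul, ← map_smul, ← map_add]
    simp only [Complex.real_smul]
    ring_nf
  rw [map_eq_zero_iff _ A.injective, mul_eq_zero_iff_left (Complex.exp_ne_zero _)] at hA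
  have hre := congrArg Complex.re hA
  have him := congrArg Complex.im hA
  simp only [Complex.ofReal_mul, Complex.add_re, Complex.ofReal_re, Complex.mul_re,
    Complex.ofReal_im, mul_zero, sub_zero, Complex.I_re, Complex.mul_im, zero_mul, add_zero,
    Complex.I_im, mul_one, sub_self, Complex.zero_re, Complex.add_im, zero_add, Complex.zero_im,
    mul_eq_zero] at hre him
  exact ⟨hre, him.resolve_right hr⟩

theorem linearIndependent_deriv_deriv {a b : ℝ} (h : Real.sin (b - a) ≠ 0) :
    LinearIndependent ℝ ![A (Complex.exp (a * Complex.I) * Complex.I),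
      A (Complex.exp (b * Complex.I) * Complex.I)] := by
  obtain ⟨δ, rfl⟩ : ∃ δ, b = a + δ := ⟨b - a, by ring⟩
  rw [add_sub_cancel_left] at h
  refine LinearIndependent.pair_iff.2 fun s t hst => ?_
  have hA : A (Complex.exp (a * Complex.I) * Complex.I *
      (s + t * Complex.exp (δ * Complex.I))) = 0 := by
    rw [← hst, ← map_smul, ← map_smul, ← map_add, Complex.ofReal_add, add_mul, Complex.exp_add]
    simp only [Complex.real_smul]
    ring_nf
  rw [map_eq_zero_iff _ A.injective, mul_eq_zero_iff_left
    (mul_ne_zero (Complex.exp_ne_zero _) Complex.I_ne_zero)] at hA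
  have hre := congrArg Complex.re hA
  have him := congrArg Complex.im hA
  simp only [Complex.add_im, Complex.ofReal_im, Complex.im_ofReal_mul,
    Complex.exp_ofReal_mul_I_im, zero_add, Complex.zero_im, mul_eq_zero, h, or_false] at him
  exact ⟨by simpa [him] using hre, him⟩

theorem exists_continuousLinearEquiv_coe_eq (hE : finrank ℝ E = 2) {u v : E}
    (h : LinearIndependent ℝ ![u, v]) : ∃ e : (ℝ × ℝ) ≃L[ℝ] E, (e : ℝ × ℝ →L[ℝ] E) =
      (ContinuousLinearMap.fst ℝ ℝ ℝ).smulRight u +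
        (ContinuousLinearMap.snd ℝ ℝ ℝ).smulRight v := by
  have : FiniteDimensional ℝ E := .of_finrank_eq_succ hE
  set L :=
    (ContinuousLinearMap.fst ℝ ℝ ℝ).smulRight u + (ContinuousLinearMap.snd ℝ ℝ ℝ).smulRight v
  have hL : L.toLinearMap.ker = ⊥ := (LinearMap.ker_eq_bot').2 fun z hz =>
    Prod.ext_iff.2 (LinearIndependent.pair_iff.1 h z.1 z.2 hz)
  exact ⟨(LinearEquiv.ofInjectiveOfFinrankEq _ (LinearMap.ker_eq_bot.1 hL)
    (by simp [hE])).toContinuousLinearEquiv, rfl⟩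

theorem ae_sin_sub_ne_zero : ∀ᵐ w : ℝ × ℝ, Real.sin (w.2 - w.1) ≠ 0 := by
  have hm : MeasurableSet {w : ℝ × ℝ | Real.sin (w.2 - w.1) ≠ 0} :=
    (measurableSet_eq_fun (by fun_prop) measurable_const).compl
  refine (Measure.ae_prod_iff_ae_ae hm).2 (Eventually.of_forall fun a => ?_)
  have hc : {b : ℝ | Real.sin (b - a) = 0}.Countable := by
    refine (countable_range fun n : ℤ => a + n * Real.pi).mono fun b hb => ?_
    obtain ⟨n, hn⟩ := Real.sin_eq_zero_iff.1 hb
    exact ⟨n, by simp [hn]⟩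
  exact hc.ae_notMem volume

theorem hasStrictFDerivAt_smul_unitPoint (w : ℝ × ℝ) :
    HasStrictFDerivAt (fun w : ℝ × ℝ => w.1 • (unitPoint A w.2 : E))
      ((ContinuousLinearMap.fst ℝ ℝ ℝ).smulRight (unitPoint A w.2 : E) +
        (ContinuousLinearMap.snd ℝ ℝ ℝ).smulRight
          (w.1 • A (Complex.exp (w.2 * Complex.I) * Complex.I))) w := by
  convert! hasStrictFDerivAt_fst.smul
    ((hasStrictDerivAt_coe_unitPoint A w.2).hasStrictFDerivAt.comp w hasStrictFDerivAt_snd) using 1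
  ext <;> simp

theorem hasStrictFDerivAt_unitPoint_add_unitPoint (w : ℝ × ℝ) :
    HasStrictFDerivAt (fun w : ℝ × ℝ => (unitPoint A w.1 + unitPoint A w.2 : E))
      ((ContinuousLinearMap.fst ℝ ℝ ℝ).smulRight
          (A (Complex.exp (w.1 * Complex.I) * Complex.I)) +
        (ContinuousLinearMap.snd ℝ ℝ ℝ).smulRight
          (A (Complex.exp (w.2 * Complex.I) * Complex.I))) w := by
  convert! ((hasStrictDerivAt_coe_unitPoint A w.1).hasStrictFDerivAt.comp w
    hasStrictFDerivAt_fst).add ((hasStrictDerivAt_coe_unitPoint A w.2).hasStrictFDerivAt.comp w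
      hasStrictFDerivAt_snd) using 1

variable [FiniteDimensional ℝ E]

theorem nonempty_complex_linearIsometryEquiv (hE : finrank ℝ E = 2) :
    Nonempty (ℂ ≃ₗᵢ[ℝ] E) :=
  ⟨(stdOrthonormalBasis ℝ ℂ).equiv (stdOrthonormalBasis ℝ E)
    (finCongr (Complex.finrank_real_complex.trans hE.symm))⟩

variable [MeasurableSpace E] [BorelSpace E]

local notation "σ" => Measure.toSphere (volume : Measure E)

theorem toSphere_eq_zero_iff_Ioo_smul (hE : finrank ℝ E ≠ 0) {s : Set 𝕊}
    (hs : MeasurableSet s) :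
    σ s = 0 ↔ volume (Ioo (0 : ℝ) 1 • ((↑) '' s : Set E)) = 0 := by
  rw [Measure.toSphere_apply' _ hs, mul_eq_zero, Nat.cast_eq_zero, or_iff_right hE]

theorem quasiMeasurePreserving_unitPoint :
    Measure.QuasiMeasurePreserving (unitPoint A) volume σ := by
  have hE := A.toLinearEquiv.finrank_eq.symm.trans Complex.finrank_real_complex
  have hu := (continuous_unitPoint A).measurable
  have hpolar : Measure.QuasiMeasurePreserving (fun w : ℝ × ℝ => w.1 • (unitPoint A w.2 : E))
      volume volume := by
    refine quasiMeasurePreserving_of_ae_hasStrictFDerivAt (by fun_prop) ?_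
    filter_upwards [Measure.quasiMeasurePreserving_fst.ae (Measure.ae_ne volume (0 : ℝ))] with w hw
    obtain ⟨e, he⟩ := exists_continuousLinearEquiv_coe_eq hE
      (linearIndependent_unitPoint_deriv A hw w.2)
    exact ⟨e, he ▸ hasStrictFDerivAt_smul_unitPoint A w⟩
  refine ⟨hu, .mk fun N hN hN0 => ?_⟩
  have hcone := hpolar.preimage_null ((toSphere_eq_zero_iff_Ioo_smul (by simp [hE]) hN).1 hN0)
  have hrect : volume (Ioo (0 : ℝ) 1 ×ˢ (unitPoint A ⁻¹' N)) = 0 := by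
    refine measure_mono_null ?_ hcone
    exact fun w hw => ⟨w.1, hw.1, _, mem_image_of_mem _ hw.2, rfl⟩
  rw [Measure.volume_eq_prod, Measure.prod_prod] at hrect
  rw [Measure.map_apply hu hN]
  simpa using hrect

theorem toSphere_absolutelyContinuous_map_unitPoint : σ ≪ volume.map (unitPoint A) := by
  have hE := A.toLinearEquiv.finrank_eq.symm.trans Complex.finrank_real_complex
  refine .mk fun N hN hN0 => (toSphere_eq_zero_iff_Ioo_smul (by simp [hE]) hN).2 ?_
  rw [Measure.map_apply (continuous_unitPoint A).measurable hN] at hN0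
  have hstrip : volume ((univ : Set ℝ) ×ˢ (unitPoint A ⁻¹' N)) = 0 := by
    rw [Measure.volume_eq_prod, Measure.prod_prod, hN0, mul_zero]
  refine measure_mono_null ?_ (addHaar_image_eq_zero_of_differentiable (by simp [hE])
    (fun w => (hasStrictFDerivAt_smul_unitPoint A w).differentiableAt) hstrip)
  rintro _ ⟨r, -, _, ⟨x, hx, rfl⟩, rfl⟩
  obtain ⟨θ, rfl⟩ := surjective_unitPoint A x
  exact ⟨(r, θ), ⟨mem_univ _, hx⟩, rfl⟩

theorem quasiMeasurePreserving_sphere_add (hE : finrank ℝ E = 2) :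
    Measure.QuasiMeasurePreserving (fun z : 𝕊 × 𝕊 => (z.1 + z.2 : E)) ((σ).prod σ) volume := by
  obtain ⟨A⟩ := nonempty_complex_linearIsometryEquiv hE
  have hu := (continuous_unitPoint A).measurable
  have hsum : Measure.QuasiMeasurePreserving
      (fun w : ℝ × ℝ => (unitPoint A w.1 + unitPoint A w.2 : E)) volume volume := by
    refine quasiMeasurePreserving_of_ae_hasStrictFDerivAt (by fun_prop) ?_
    filter_upwards [ae_sin_sub_ne_zero] with w hw
    obtain ⟨e, he⟩ := exists_continuousLinearEquiv_coe_eq hE (linearIndependent_deriv_deriv A hw)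
    exact ⟨e, he ▸ hasStrictFDerivAt_unitPoint_add_unitPoint A w⟩
  have hac := toSphere_absolutelyContinuous_map_unitPoint A
  refine ⟨by fun_prop, ((hac.prod hac).map (by fun_prop)).trans ?_⟩
  rw [Measure.map_prod_map _ _ hu hu, Measure.map_map (by fun_prop) (by fun_prop)]
  exact hsum.absolutelyContinuous

theorem ae_of_sphere_add_eq (hE : finrank ℝ E = 2) {ρ : 𝕊 × 𝕊 → Prop} (h : ∀ᵐ z ∂(σ).prod σ, ρ z)
    {p q : E → 𝕊} (hpq : ∀ v, ‖v‖ ≤ 2 → (p v + q v : E) = v) :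
    ∀ᵐ v, ‖v‖ ≤ 2 → ρ (p v, q v) := by
  obtain ⟨A⟩ := nonempty_complex_linearIsometryEquiv hE
  have hangle : ∀ᵐ w : ℝ × ℝ, ρ (unitPoint A w.1, unitPoint A w.2) :=
    (QuasiMeasurePreserving.prodMap (quasiMeasurePreserving_unitPoint A)
      (quasiMeasurePreserving_unitPoint A)).ae h
  have himage := addHaar_image_eq_zero_of_differentiable (τ := (volume : Measure E)) (by simp [hE])
    (fun w => (hasStrictFDerivAt_unitPoint_add_unitPoint A w).differentiableAt) (ae_iff.1 hangle)
  filter_upwards [measure_eq_zero_iff_ae_notMem.1 himage] with v hv hv2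
  by_contra hρ
  obtain ⟨a, ha⟩ := surjective_unitPoint A (p v)
  obtain ⟨b, hb⟩ := surjective_unitPoint A (q v)
  exact hv ⟨(a, b), by rwa [← ha, ← hb] at hρ, by simp only [ha, hb, hpq v hv2]⟩

theorem ae_of_sphere_sub_eq (hE : finrank ℝ E = 2) {ρ : 𝕊 × 𝕊 → Prop} (h : ∀ᵐ z ∂(σ).prod σ, ρ z)
    {p q : E → 𝕊} (hpq : ∀ v, ‖v‖ ≤ 2 → (p v - q v : E) = v) :
    ∀ᵐ v, ‖v‖ ≤ 2 → ρ (p v, q v) := by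
  have hneg : MeasurePreserving (fun z : 𝕊 => -z) σ σ :=
    measurePreserving_sphereMap (LinearIsometryEquiv.neg ℝ)
  have h' := ae_of_sphere_add_eq hE
    (((MeasurePreserving.id σ).prod hneg).quasiMeasurePreserving.ae h) (p := p)
    (q := fun v => -q v) fun v hv => (coe_add_coe_neg_sphere _ _).trans (hpq v hv)
  simpa only [Prod.map, id, neg_neg] using h'

theorem ae_translate_mul_eq {F : 𝕊 → ℂ} {P H : E → ℂ} {R : ℝ}
    (h : ∀ᵐ z : 𝕊 ∂σ, ∀ᵐ s : E, ‖s‖ ≤ R → P s * F z = H (s + z)) :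
    ∀ᵐ w : 𝕊 × 𝕊 ∂(σ).prod σ, ∀ᵐ s : E, ‖s‖ ≤ R → ‖s + (w.1 - w.2)‖ ≤ R →
      P (s + (w.1 - w.2)) * F w.2 = P s * F w.1 := by
  filter_upwards [Measure.quasiMeasurePreserving_fst.ae h,
    Measure.quasiMeasurePreserving_snd.ae h] with w h₁ h₂
  have h₂' := (measurePreserving_add_right volume (w.1 - w.2 : E)).quasiMeasurePreserving.ae h₂
  filter_upwards [h₁, h₂'] with s hs₁ hs₂ hs hs'
  rw [hs₁ hs, hs₂ hs', add_assoc, sub_add_cancel]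

theorem exists_radius_not_ae_eq_zero {P : E → ℂ} {R : ℝ} (hR : R ≠ 0)
    (h : ¬ ∀ᵐ s, ‖s‖ ≤ R → P s = 0) : ∃ δ > 0, ¬ ∀ᵐ s, ‖s‖ ≤ R - δ → P s = 0 := by
  by_contra! hc
  refine h ?_
  have hn : ∀ᵐ s, ∀ n : ℕ, ‖s‖ ≤ R - 1 / (n + 1 : ℝ) → P s = 0 :=
    ae_all_iff.2 fun n => hc _ Nat.one_div_pos_of_nat
  filter_upwards [hn, measure_eq_zero_iff_ae_notMem.1
    (Measure.addHaar_sphere_of_ne_zero volume 0 hR)] with s hs₁ hs₂ hs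
  rw [mem_sphere_zero_iff_norm] at hs₂
  obtain ⟨n, hn⟩ := exists_nat_one_div_lt (sub_pos.2 (lt_of_le_of_ne hs hs₂))
  exact hs₁ n (by linarith)

/-- By the translation relation the zero set of `F` is, up to null sets, invariant under small
displacements, and the sphere is connected. -/
theorem ae_ne_zero_of_translation (hE : 2 ≤ finrank ℝ E) {F : 𝕊 → ℂ} {P : E → ℂ} {R : ℝ}
    (hR : R ≠ 0) (hP : ¬ ∀ᵐ s, ‖s‖ ≤ R → P s = 0) (hF : ¬ ∀ᵐ z ∂σ, F z = 0)
    (h : ∀ᵐ w : 𝕊 × 𝕊 ∂(σ).prod σ, ∀ᵐ s : E, ‖s‖ ≤ R → ‖s + (w.1 - w.2)‖ ≤ R →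
      P (s + (w.1 - w.2)) * F w.2 = P s * F w.1) : ∀ᵐ z ∂σ, F z ≠ 0 := by
  obtain ⟨δ, hδ, hPδ⟩ := exists_radius_not_ae_eq_zero hR hP
  have hsupp {z z' : 𝕊} (hzz : dist z z' < δ) (hz' : F z' = 0)
      (h : ∀ᵐ s : E, ‖s‖ ≤ R → ‖s + (z - z')‖ ≤ R → P (s + (z - z')) * F z' = P s * F z) :
      F z = 0 := by
    by_contra hz
    refine hPδ ?_
    rw [Subtype.dist_eq, dist_eq_norm] at hzz
    filter_upwards [h] with s hs hsδ
    have hPs := hs (by linarith) ((norm_add_le _ _).trans (by linarith))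
    rw [hz', mul_zero] at hPs
    exact (mul_eq_zero.1 hPs.symm).resolve_right hz
  have := connectedSpace_sphere hE
  obtain ⟨c, hc⟩ := ae_eq_const_of_ae_dist_lt (u := fun z => F z = 0) σ hδ (by
    filter_upwards [Measure.ae_ae_of_ae_prod h, Measure.ae_ae_of_ae_prod
      (Measure.measurePreserving_swap.quasiMeasurePreserving.ae h)] with z' h₁ h₂
    filter_upwards [h₁, h₂] with z hz₁ hz₂ hzz
    exact propext ⟨fun hz => hsupp (by rwa [dist_comm]) hz hz₁, fun hz => hsupp hzz hz hz₂⟩)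
  have hcF : ¬ c := fun hcT => hF (hc.mono fun z hz => hz.mpr hcT)
  exact hc.mono fun z hz h => hcF (hz.mp h)

section Triple

variable {F : sphere (0 : E) 1 → ℂ} {H : E → ℂ} {p q : E → sphere (0 : E) 1}

/-- `F (p s) * F (-q s)` is `F x * F y` for points `x` and `y` of the sphere with `x + y = s`, the
quantity called `P s` from here on. -/
theorem ae_mul_eq_of_add_eq (hE : finrank ℝ E = 2)
    (hH : ∀ᵐ z ∂(σ).prod ((σ).prod σ), F z.1 * (F z.2.1 * F z.2.2) = H (z.1 + (z.2.1 + z.2.2)))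
    (hpq : ∀ v, ‖v‖ ≤ 2 → (p v - q v : E) = v) :
    ∀ᵐ z : 𝕊 ∂σ, ∀ᵐ s : E, ‖s‖ ≤ 2 → F (p s) * F (-q s) * F z = H (s + z) := by
  filter_upwards [Measure.ae_ae_of_ae_prod hH] with z hz
  have hpq' (v : E) (hv : ‖v‖ ≤ 2) : (p v + (-q v : 𝕊) : E) = v :=
    (coe_add_coe_neg_sphere _ _).trans (hpq v hv)
  filter_upwards [ae_of_sphere_add_eq hE hz hpq'] with s hs hs2
  rw [mul_comm, hs hs2, hpq' s hs2, add_comm]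

theorem not_ae_mul_eq_zero (hE : finrank ℝ E = 2) (hF : ¬ ∀ᵐ z ∂σ, F z = 0)
    (hH : ∀ᵐ z ∂(σ).prod ((σ).prod σ), F z.1 * (F z.2.1 * F z.2.2) = H (z.1 + (z.2.1 + z.2.2)))
    (hpq : ∀ v, ‖v‖ ≤ 2 → (p v - q v : E) = v) :
    ¬ ∀ᵐ s : E, ‖s‖ ≤ 2 → F (p s) * F (-q s) = 0 := by
  intro h0
  obtain ⟨z, hz, hz₁, hz₂⟩ := ((not_eventually.1 hF).and_eventually
    ((Measure.ae_ae_of_ae_prod hH).and (ae_mul_eq_of_add_eq hE hH hpq))).exists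
  have hsum := quasiMeasurePreserving_sphere_add hE
  have hFF : ∀ᵐ w ∂(σ).prod σ, F w.1 * F w.2 = 0 := by
    filter_upwards [hz₁, hsum.ae hz₂, hsum.ae h0] with w hw₁ hw₂ hw₃
    have hw : ‖(w.1 + w.2 : E)‖ ≤ 2 := (norm_add_le _ _).trans (by
      simp only [norm_eq_of_mem_sphere]
      norm_num)
    refine (mul_eq_zero.1 ?_).resolve_left hz
    rw [hw₁, add_comm, ← hw₂ hw, hw₃ hw, zero_mul]
  refine hF ?_
  filter_upwards [Measure.ae_ae_of_ae_prod hFF] with x hx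
  by_contra hne
  exact hF (hx.mono fun y hy => (mul_eq_zero.1 hy).resolve_left hne)

theorem ae_mul_eq_mul_div (hE : finrank ℝ E = 2) (hF : Measurable F)
    (hF0 : ∀ᵐ z ∂σ, F z ≠ 0) (hp : Measurable p) (hq : Measurable q)
    (hpq : ∀ v, ‖v‖ ≤ 2 → (p v - q v : E) = v) {P : E → ℂ} (hP : Measurable P)
    (h : ∀ᵐ w : 𝕊 × 𝕊 ∂(σ).prod σ, ∀ᵐ s : E, ‖s‖ ≤ 2 → ‖s + (w.1 - w.2)‖ ≤ 2 →
      P (s + (w.1 - w.2)) * F w.2 = P s * F w.1) :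
    ∀ᵐ z : E × E, z.1 ∈ ball 0 1 → z.2 ∈ ball 0 1 →
      P (z.1 + z.2) = P z.1 * (F (p z.2) / F (q z.2)) := by
  have hm : MeasurableSet {z : E × E | z.1 ∈ ball 0 1 → z.2 ∈ ball 0 1 →
      P (z.1 + z.2) = P z.1 * (F (p z.2) / F (q z.2))} :=
    (measurable_fst measurableSet_ball).imp ((measurable_snd measurableSet_ball).imp
      (measurableSet_eq_fun (by fun_prop) (by fun_prop)))
  rw [Measure.volume_eq_prod, Measure.ae_prod_iff_ae_ae hm]
  refine (Measure.ae_ae_comm (p := fun s v : E => s ∈ ball 0 1 → v ∈ ball 0 1 →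
    P (s + v) = P s * (F (p v) / F (q v))) hm).2 ?_
  filter_upwards [ae_of_sphere_sub_eq hE h hpq,
    ae_of_sphere_sub_eq hE (Measure.quasiMeasurePreserving_snd.ae hF0) hpq] with v hv hv0
  by_cases hv1 : ‖v‖ < 1
  · filter_upwards [hv (by linarith)] with s hs hs1 _
    rw [mem_ball_zero_iff] at hs1
    rw [hpq v (by linarith)] at hs
    rw [← mul_div_assoc, eq_div_iff (hv0 (by linarith)),
      hs (by linarith) ((norm_add_le _ _).trans (by linarith))]
  · exact .of_forall fun s _ h => absurd (mem_ball_zero_iff.1 h) hv1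

theorem exists_ae_eq_const_mul_exp_of_ae_mul_mul_eq (hE : finrank ℝ E = 2) (hF : AEMeasurable F σ)
    (hF0 : ¬ ∀ᵐ z ∂σ, F z = 0)
    (hH : ∀ᵐ z ∂(σ).prod ((σ).prod σ), F z.1 * (F z.2.1 * F z.2.2) = H (z.1 + (z.2.1 + z.2.2))) :
    ∃ c ≠ 0, ∃ l : E →L[ℝ] ℂ, ∀ᵐ z ∂σ, F z = c * Complex.exp (l z) := by
  wlog hFm : Measurable F generalizing F
  · have hmk := hF.ae_eq_mk
    obtain ⟨c, hc, l, hl⟩ := this hF.measurable_mk.aemeasurable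
      (fun h => hF0 (hmk.trans h)) (by
        have hmk₂ := Measure.quasiMeasurePreserving_snd (μ := σ) (ν := (σ).prod σ)
        filter_upwards [hH, Measure.quasiMeasurePreserving_fst.ae hmk,
          (Measure.quasiMeasurePreserving_fst.comp hmk₂).ae hmk,
          (Measure.quasiMeasurePreserving_snd.comp hmk₂).ae hmk] with z hz h₁ h₂ h₃
        simp only [Function.comp_apply] at h₂ h₃
        rw [← h₁, ← h₂, ← h₃, hz]) hF.measurable_mk
    exact ⟨c, hc, l, hmk.trans hl⟩
  obtain ⟨p, q, hp, hq, hpq⟩ := exists_measurable_sphere_sub_eq hE.ge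
  have htr := ae_translate_mul_eq (ae_mul_eq_of_add_eq hE hH hpq)
  have hne := ae_ne_zero_of_translation hE.ge two_ne_zero (not_ae_mul_eq_zero hE hF0 hH hpq) hF0 htr
  have hP : Measurable fun s => F (p s) * F (-q s) :=
    (hFm.comp hp).mul (hFm.comp (continuous_neg.measurable.comp hq))
  refine exists_ae_eq_const_mul_exp_of_translation hE.ge (P := fun s => F (p s) * F (-q s))
    (χ := fun v => F (p v) / F (q v)) hP (by fun_prop) one_pos
    (ae_mul_eq_mul_div hE hFm hne hp hq hpq hP htr) ?_ hF0 ?_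
  · have hpq' (v : E) (hv : ‖v‖ ≤ 2) : (p v + (-q v : 𝕊) : E) = v :=
      (coe_add_coe_neg_sphere _ _).trans (hpq v hv)
    filter_upwards [ae_of_sphere_add_eq hE (Measure.quasiMeasurePreserving_fst.ae hne) hpq',
      ae_of_sphere_add_eq hE (Measure.quasiMeasurePreserving_snd.ae hne) hpq'] with s h₁ h₂ hs
    have hs2 : ‖s‖ ≤ 2 := by linarith [mem_ball_zero_iff.1 hs]
    exact mul_ne_zero (h₁ hs2) (h₂ hs2)
  · filter_upwards [Measure.ae_ae_of_ae_prod
      (Measure.measurePreserving_swap.quasiMeasurePreserving.ae htr)] with z' hz'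
    filter_upwards [hz'] with z hz hdist
    rw [Subtype.dist_eq, dist_eq_norm] at hdist
    filter_upwards [hz] with s hs hs1
    rw [mem_ball_zero_iff] at hs1
    exact hs (by linarith) ((norm_add_le _ _).trans (by simp only [Prod.swap]; linarith))

end Triple

end Plane

theorem theorem4_general {E ι : Type*} [NormedAddCommGroup E] [InnerProductSpace ℝ E]
    [FiniteDimensional ℝ E] [MeasurableSpace E] [BorelSpace E] [Fintype ι]
    (hE : 2 ≤ finrank ℝ E) (hι : 2 ≤ Fintype.card ι)
    (hEι : (finrank ℝ E, Fintype.card ι) ≠ (2, 2)) (f : ι → sphere (0 : E) 1 → ℂ)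
    (hf : ∀ j, AEMeasurable (f j) (volume : Measure E).toSphere) (h : E → ℂ)
    (heq : ∀ᵐ ζ : ι → sphere (0 : E) 1 ∂Measure.pi fun _ : ι => (volume : Measure E).toSphere,
      ∏ j, f j (ζ j) = h (∑ j, (ζ j : E))) :
    (∃ (c : ι → ℂ) (l : E →L[ℝ] ℂ), (∀ j, c j ≠ 0) ∧
      ∀ j, ∀ᵐ ζ : sphere (0 : E) 1 ∂(volume : Measure E).toSphere,
        f j ζ = c j * Complex.exp (l ζ)) ∨
    (∃ j, ∀ᵐ ζ ∂(volume : Measure E).toSphere, f j ζ = 0) := by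
  refine or_iff_not_imp_right.2 fun hf0 => ?_
  rw [not_exists] at hf0
  obtain ⟨i⟩ : Nonempty ι := Fintype.card_pos_iff.1 (by lia)
  obtain ⟨c, hc, l, hl⟩ : ∃ c ≠ 0, ∃ l : E →L[ℝ] ℂ,
      ∀ᵐ ζ : sphere (0 : E) 1 ∂(volume : Measure E).toSphere, f i ζ = c * Complex.exp (l ζ) := by
    obtain hE2 | hE3 := hE.eq_or_lt
    · have hι3 : 3 ≤ Fintype.card ι := hι.lt_of_ne fun hι2 => hEι (by rw [← hE2, ← hι2])
      obtain ⟨H, hH⟩ := exists_ae_mul_mul_self_eq (p := Subtype.val) hι3 i hf0 heq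
      exact exists_ae_eq_const_mul_exp_of_ae_mul_mul_eq hE2.symm (hf i) (hf0 i) hH
    · obtain ⟨H, hH⟩ := exists_ae_mul_self_eq (p := Subtype.val) hι i hf0 heq
      exact exists_ae_eq_const_mul_exp_of_ae_mul_eq hE3 (hf i) (hf0 i) hH
  choose a ha hfa using exists_ae_eq_const_mul_of_ae_prod_eq (p := Subtype.val) i hf0 heq
  refine ⟨fun j => a j * c, l, fun j => mul_ne_zero (ha j) hc, fun j => ?_⟩
  filter_upwards [hfa j, hl] with ζ hj hi
  rw [hj, hi, mul_assoc]

theorem exists_complexDot_eq {d : ℕ} (l : EuclideanSpace ℝ (Fin d) →L[ℝ] ℂ) :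
    ∃ ν : Fin d → ℂ, ∀ x, complexDot ν x = l x := by
  refine ⟨fun i => l (EuclideanSpace.single i 1), fun x => ?_⟩
  have hx : x = ∑ i, x i • EuclideanSpace.single i (1 : ℝ) := by
    simpa using ((EuclideanSpace.basisFun (Fin d) ℝ).sum_repr x).symm
  conv_rhs => rw [hx]
  simp [complexDot, mul_comm]

theorem theorem4 (d k : ℕ) (hd : 2 ≤ d) (hk : 2 ≤ k) (hdk : (d, k) ≠ (2, 2))
    (f : Fin k → UnitSphere d → ℂ)
    (hf : ∀ j, AEMeasurable (f j) (surfaceMeasure d))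
    (h : EuclideanSpace ℝ (Fin d) → ℂ)
    (hh : AEMeasurable h
      ((volume : Measure (EuclideanSpace ℝ (Fin d))).restrict (closedBall 0 (k : ℝ))))
    (heq : ∀ᵐ ζ : Fin k → UnitSphere d ∂(Measure.pi fun _ : Fin k => surfaceMeasure d),
      ∏ j, f j (ζ j) = h (∑ j, (ζ j : EuclideanSpace ℝ (Fin d)))) :
    (∃ (c : Fin k → ℂ) (ν : Fin d → ℂ), (∀ j, c j ≠ 0) ∧
      ∀ j, ∀ᵐ ζ ∂(surfaceMeasure d),
        f j ζ = c j * Complex.exp (complexDot ν (ζ : EuclideanSpace ℝ (Fin d)))) ∨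
    (∃ j, ∀ᵐ ζ ∂(surfaceMeasure d), f j ζ = 0) := by
  obtain ⟨c, l, hc, hcl⟩ | h0 := theorem4_general (by simpa using hd) (by simpa using hk)
    (by simpa using hdk) f hf h heq
  · obtain ⟨ν, hν⟩ := exists_complexDot_eq l
    exact .inl ⟨c, ν, hc, fun j => (hcl j).mono fun ζ hζ => by rw [hζ, hν]⟩
  · exact .inr h0
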